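/- **Setting.** Let $\mathcal K\subset\mathbb R^n$ be compact with polar body $\mathcal K^\circ=\{h:\ |h\cdot x|\le 1\ \ \forall x\in\mathcal K\}$. In the starved bandit on $\mathcal K$ with horizon $T$ and losses $\ell_1,\dots,\ell_T\in\mathbb R^n$ that are fixed in advance, the player, who may use private randomness, decides at each round $t$ whether to play $a_t$ from a fixed exploration distribution $\mu$ on $\mathcal K$ or to choose $a_t\in\mathcal K$ herself; these decisions depend only on her private randomness and on the feedback observed so far. If $a_t$ was played from $\mu$ she observes $a_t$ and $\ell_t\cdot a_t$; otherwise she gets no feedback. In either case she suffers the loss $\ell_t\cdot a_t$. Her pseudo-regret is $$R_T=\mathbb E\sum_{t=1}^T \ell_t\cdot a_t-\min_{x\in\mathcal K}\sum_{t=1}^T\ell_t\cdot x,$$ the expectation being over the randomness in her play (the draws from $\mu$ included). In the multi-armed bandit $\mathcal K=\{e_1,\dots,e_n\}$ and $\mu$ is uniform on $\{e_1,\dots,e_n\}$; on the unit ball of $\ell_p^n$, $\mu$ is uniform on the signed canonical basis $\{\pm e_1,\dots,\pm e_n\}$. **Theorem 5.** (i) Let $n\ge 3$ and $T\ge n$.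 For any strategy for the starved multi-armed bandit there exists a loss sequence $\ell_1,\dots,\ell_T\in\mathcal K^\circ=[-1,1]^n$ such that $R_T\ge\frac1{20}n^{1/3}T^{2/3}$. (ii) Let $n\ge 2$ and $T\ge n$. For any strategy for the starved linear bandit on the unit ball of $\ell_1^n$ there exists a loss sequence $\ell_1,\dots,\ell_T\in\mathcal K^\circ=[-1,1]^n$ such that $R_T\ge\frac1{20}n^{1/3}T^{2/3}$. (iii) Let $p\in(2,\infty]$ and let $q\in[1,2)$ be the conjugate exponent, $\frac1p+\frac1q=1$. There exists a constant $C>0$ such that for all $n\ge 2$, all $T\ge n$ and any strategy for the starved linear bandit on the unit ball of $\ell_p^n$, there exist i.i.d. Gaussian random vectors $\ell_1,\dots,\ell_T$ in $\mathbb R^n$, independent of the randomness in the strategy, with $\mathbb E\|\ell_t\|_q^q\le 1$ and $$\mathbb E R_T\ge C\,n^{\frac q{2+q}}\,T^{\frac2{2+q}},$$ where the expectation is over the losses, $R_T$ being the pseudo-regret given the losses. -/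

import Mathlib

open MeasureTheory ProbabilityTheory
open scoped ENNReal Matrix BigOperators

namespace StarvedBandit

/-- What the player observes in one round: `inl ()` (nothing) if the round was not played from the
exploration distribution, and `inr (i, y)` if it was, where `i` is the exploratory action that was
drawn and `y` is the loss that was suffered. -/
abbrev Signal (ι : Type) : Type := Unit ⊕ (ι × ℝ)

/-- A randomized strategy for the starved linear bandit on the action set `K ⊆ ℝⁿ`, whose
exploration distribution is carried by actions indexed by `ι`.  The player draws a private seed
`ω : Ω` from `law`.  In each round `t` (rounds are numbered from `0`), knowing the seed and the
signals of the rounds before `t`, she decides whether the round is played from the exploration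
distribution; if it is not, she plays the point `action t ω h` of `K`. -/
structure Strategy (Ω : Type*) [MeasurableSpace Ω] (ι : Type) [MeasurableSpace ι] {n : ℕ}
    (K : Set (Fin n → ℝ)) where
  /-- the law of the player's private randomness -/
  law : Measure Ω
  isProbabilityMeasure_law : IsProbabilityMeasure law
  /-- whether round `t` is played from the exploration distribution -/
  explore : (t : ℕ) → Ω → (Fin t → Signal ι) → Bool
  /-- the action of round `t` when it is not played from the exploration distribution -/
  action : (t : ℕ) → Ω → (Fin t → Signal ι) → (Fin n → ℝ)
  action_mem : ∀ t ω h, action t ω h ∈ K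
  measurable_explore : ∀ t, Measurable (Function.uncurry (explore t))
  measurable_action : ∀ t, Measurable (Function.uncurry (action t))

namespace Strategy

variable {Ω : Type*} [MeasurableSpace Ω] {ι : Type} [MeasurableSpace ι] {n T : ℕ}
  {K : Set (Fin n → ℝ)}

/-- The signals of the first `t` rounds, for the seed `ω` and the losses `ℓ`; `v i` is the
exploratory action with index `i`, and `u s` is the index drawn for round `s` (it is used only if
round `s` is played from the exploration distribution). -/
def history (S : Strategy Ω ι K) (v : ι → Fin n → ℝ) (ℓ : Fin T → Fin n → ℝ) (u : Fin T → ι)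
    (ω : Ω) : (t : ℕ) → t ≤ T → (Fin t → Signal ι)
  | 0, _ => Fin.elim0
  | t + 1, ht =>
      Fin.snoc (α := fun _ => Signal ι) (history S v ℓ u ω t (Nat.le_of_succ_le ht))
        (if S.explore t ω (history S v ℓ u ω t (Nat.le_of_succ_le ht)) = true then
          Sum.inr (u ⟨t, ht⟩, ℓ ⟨t, ht⟩ ⬝ᵥ v (u ⟨t, ht⟩))
        else Sum.inl ())

/-- The action `a_t` that is played in round `t`. -/
def played (S : Strategy Ω ι K) (v : ι → Fin n → ℝ) (ℓ : Fin T → Fin n → ℝ) (u : Fin T → ι)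
    (ω : Ω) (t : Fin T) : Fin n → ℝ :=
  if S.explore t ω (S.history v ℓ u ω t t.isLt.le) = true then v (u t)
  else S.action t ω (S.history v ℓ u ω t t.isLt.le)

/-- The pseudo-regret `R_T = 𝔼 ∑ₜ ℓₜ(aₜ) - min_{x ∈ K} ∑ₜ ℓₜ(x)` on the losses `ℓ`, when the
exploration distribution is uniform on the family `v`.  The expectation is over the exploratory
draws, which are independent and uniform on `ι`, and over the independent seed. -/
noncomputable def regret [Fintype ι] (S : Strategy Ω ι K) (v : ι → Fin n → ℝ)
    (ℓ : Fin T → Fin n → ℝ) : ℝ :=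
  (Finset.univ : Finset (Fin T → ι)).expect
      (fun u => ∫ ω, ∑ t, ℓ t ⬝ᵥ S.played v ℓ u ω t ∂S.law)
    - sInf ((fun x => ∑ t, ℓ t ⬝ᵥ x) '' K)

end Strategy

/-- The polar body: the loss vectors `h` with `|h · x| ≤ 1` for all `x ∈ K`. -/
def polarBody {n : ℕ} (K : Set (Fin n → ℝ)) : Set (Fin n → ℝ) :=
  {h | ∀ x ∈ K, |h ⬝ᵥ x| ≤ 1}

/-- The canonical basis `e_1, …, e_n` of `ℝⁿ`. -/
def basisVec {n : ℕ} (i : Fin n) : Fin n → ℝ := Pi.single i 1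

/-- The signed canonical basis `± e_1, …, ± e_n`. -/
def signedBasisVec {n : ℕ} (i : Fin n × Bool) : Fin n → ℝ :=
  if i.2 = true then basisVec i.1 else -basisVec i.1

/-- The `ℓ_p` norm on `ℝⁿ`. -/
noncomputable def ellNorm {n : ℕ} (p : ℝ≥0∞) (x : Fin n → ℝ) : ℝ := ‖WithLp.toLp p x‖

/-- The unit ball of `ℓ_p^n`. -/
def ellBall (n : ℕ) (p : ℝ≥0∞) : Set (Fin n → ℝ) := {x | ellNorm p x ≤ 1}

/-- The action set of the multi-armed bandit: the canonical basis. -/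
def arms (n : ℕ) : Set (Fin n → ℝ) := Set.range basisVec

end StarvedBandit

/-! Information comes only from explored rounds, and each of them costs a constant amount of regret.
The adversary draws i.i.d. losses whose mean hides a perturbation of size `ε`. A draw hits a given
coordinate with probability `1/n`, so one explored round lowers the Hellinger affinity between the
laws with and without the perturbation of that coordinate by at most a quantity of order `ε²/n`.
Detection thus takes about `n/ε²` explored rounds.

For the arms and the `ℓ_1` ball, one coordinate is slightly better than the other candidates.
Missing it costs `ε` per round, and the balance `n/ε² = εT` gives `ε ≈ (n/T)^(1/3)` and regret of
order `n^(1/3) T^(2/3)`. For the `ℓ_p` ball with `p > 2`, every coordinate but one hides a sign;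
noise has size about `n^(-1/q)` and the signal is `ε` times that. All wrong signs together cost
about `ε^q` per round, so the balance is `n/ε² = ε^q T`. The remaining coordinate is known and
large, which makes exploration expensive.

The information bound is `one_le_affinity_add`, converted into a bound on test errors by
`two_thirds_le_test`. It charges each law with its own expected number of explored rounds, so no a
priori bound on exploration is needed: either law pays for its exploration with its own regret.
`sum_integral_le_integral_regret` reduces the regret to mean losses. The conclusion is an average
over the position of the good coordinate (`needle_of_sums`) or over all sign vectors
(`exists_signs_of_sums`). For bounded losses, `exists_loss_of_le_integral_regret` then selects a
fixed sequence. -/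

namespace StarvedBandit

/-! ### Uniform draws and resampling in a product law -/

/-- The uniform distribution on a finite type. -/
noncomputable def unif (ι : Type) [Fintype ι] [MeasurableSpace ι] : Measure ι :=
  (Fintype.card ι : ℝ≥0∞)⁻¹ • Measure.count

section Unif

variable {ι : Type} [Fintype ι] [MeasurableSpace ι] [MeasurableSingletonClass ι]

instance [Nonempty ι] : IsProbabilityMeasure (unif ι) where
  measure_univ := by
    simp only [unif, Measure.smul_apply, Measure.count_univ, smul_eq_mul, ENat.card_eq_coe_fintype_card]
    exact ENNReal.inv_mul_cancel (by simp) (by simp)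

lemma lintegral_unif (f : ι → ℝ≥0∞) :
    ∫⁻ u, f u ∂unif ι = (Fintype.card ι : ℝ≥0∞)⁻¹ * ∑ u, f u := by
  rw [unif, lintegral_smul_measure, lintegral_count, tsum_fintype, smul_eq_mul]

lemma integral_unif (f : ι → ℝ) :
    ∫ u, f u ∂unif ι = Finset.univ.expect f := by
  rw [unif, integral_smul_measure, integral_count, Fintype.expect_eq_sum_div_card]
  simp [div_eq_inv_mul]

lemma pi_unif [Nonempty ι] (T : ℕ) : Measure.pi (fun _ : Fin T => unif ι) = unif (Fin T → ι) := by
  refine Measure.ext_of_singleton fun u => ?_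
  rw [Measure.pi_singleton]
  simp [unif, Finset.prod_const, ENNReal.inv_pow]

end Unif

/-- Replacing one coordinate of a product law by an independent copy preserves the law. -/
lemma measurePreserving_update {T : ℕ} {W : Type*} [MeasurableSpace W] (ρ : Measure W)
    [IsProbabilityMeasure ρ] (t : Fin T) :
    MeasurePreserving (fun p : (Fin T → W) × W => Function.update p.1 t p.2)
      ((Measure.pi fun _ => ρ).prod ρ) (Measure.pi fun _ => ρ) := by
  have hm : Measurable (fun p : (Fin T → W) × W => Function.update p.1 t p.2) := by
    refine measurable_pi_iff.2 fun i => ?_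
    by_cases h : i = t
    · subst h; simpa using measurable_snd
    · simp only [Function.update_of_ne h]
      exact (measurable_pi_apply i).comp measurable_fst
  refine ⟨hm, (Measure.pi_eq fun s hs => ?_).symm⟩
  rw [Measure.map_apply hm (MeasurableSet.univ_pi hs)]
  have : (fun p : (Fin T → W) × W => Function.update p.1 t p.2) ⁻¹' Set.univ.pi s
      = (Set.univ.pi (Function.update s t Set.univ)) ×ˢ s t := by
    ext ⟨z, w⟩
    simp only [Set.mem_preimage, Set.mem_univ_pi, Set.mem_prod]
    constructor
    · intro h
      refine ⟨fun i => ?_, by simpa using h t⟩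
      by_cases hi : i = t
      · subst hi; simp
      · simpa [Function.update_of_ne hi] using h i
    · rintro ⟨h, hw⟩ i
      by_cases hi : i = t
      · subst hi; simpa using hw
      · simpa [Function.update_of_ne hi] using h i
  rw [this, Measure.prod_prod, Measure.pi_pi, ← Finset.mul_prod_erase _ _ (Finset.mem_univ t),
    ← Finset.mul_prod_erase Finset.univ (fun i => ρ (s i)) (Finset.mem_univ t), mul_comm]
  simp only [Function.update_self, measure_univ, one_mul]
  congr 1
  refine Finset.prod_congr rfl fun i hi => ?_
  rw [Function.update_of_ne (Finset.ne_of_mem_erase hi)]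

/-! ### The law of the seed and the history -/

namespace Strategy

variable {Ω : Type*} [MeasurableSpace Ω] {ι : Type} [MeasurableSpace ι] {n T : ℕ}
  {K : Set (Fin n → ℝ)}

instance (S : Strategy Ω ι K) : IsProbabilityMeasure S.law := S.isProbabilityMeasure_law

/-- The history of a play, as a function of the sequence of pairs (exploratory draw, loss). -/
def hist (S : Strategy Ω ι K) (v : ι → Fin n → ℝ) {t : ℕ} (ht : t ≤ T)
    (p : Ω × (Fin T → ι × (Fin n → ℝ))) : Fin t → Signal ι :=
  S.history v (fun s => (p.2 s).2) (fun s => (p.2 s).1) p.1 t ht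

/-- The signal of a round, given the past and the pair (exploratory draw, loss). -/
def signal (S : Strategy Ω ι K) (v : ι → Fin n → ℝ) (t : ℕ)
    (p : (Ω × (Fin t → Signal ι)) × (ι × (Fin n → ℝ))) : Signal ι :=
  if S.explore t p.1.1 p.1.2 = true then Sum.inr (p.2.1, p.2.2 ⬝ᵥ v p.2.1) else Sum.inl ()

/-- One round of the play. -/
def step (S : Strategy Ω ι K) (v : ι → Fin n → ℝ) (t : ℕ)
    (p : (Ω × (Fin t → Signal ι)) × (ι × (Fin n → ℝ))) : Ω × (Fin (t + 1) → Signal ι) :=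
  (p.1.1, Fin.snoc (α := fun _ => Signal ι) p.1.2 (S.signal v t p))

lemma hist_succ (S : Strategy Ω ι K) (v : ι → Fin n → ℝ) {t : ℕ} (ht : t + 1 ≤ T)
    (p : Ω × (Fin T → ι × (Fin n → ℝ))) :
    (p.1, S.hist v ht p)
      = S.step v t ((p.1, S.hist v (Nat.le_of_succ_le ht) p), p.2 ⟨t, ht⟩) := rfl

lemma hist_congr (S : Strategy Ω ι K) (v : ι → Fin n → ℝ) {t : ℕ} (ht : t ≤ T) (ω : Ω)
    (z z' : Fin T → ι × (Fin n → ℝ)) (h : ∀ s : Fin T, (s : ℕ) < t → z s = z' s) :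
    S.hist v ht (ω, z) = S.hist v ht (ω, z') := by
  induction t with
  | zero => rfl
  | succ t ih =>
    have h1 := ih (Nat.le_of_succ_le ht) fun s hs => h s (by omega)
    have h2 := h ⟨t, ht⟩ (by simp)
    have e1 := congrArg Prod.snd (S.hist_succ v ht (ω, z))
    have e2 := congrArg Prod.snd (S.hist_succ v ht (ω, z'))
    simp only at e1 e2
    rw [e1, e2, h1, h2]

lemma measurableSet_explore (S : Strategy Ω ι K) (t : ℕ) :
    MeasurableSet {x : Ω × (Fin t → Signal ι) | S.explore t x.1 x.2 = true} :=
  S.measurable_explore t (measurableSet_singleton true)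

lemma measurable_snoc (t : ℕ) : Measurable fun p : (Fin t → Signal ι) × Signal ι =>
    Fin.snoc (α := fun _ => Signal ι) p.1 p.2 := by
  refine measurable_pi_iff.2 fun i => ?_
  refine Fin.lastCases ?_ (fun j => ?_) i
  · simpa using measurable_snd
  · simp only [Fin.snoc_castSucc]
    exact (measurable_pi_apply j).comp measurable_fst

variable [Fintype ι] [MeasurableSingletonClass ι]

lemma measurable_dot (v : ι → Fin n → ℝ) :
    Measurable fun w : ι × (Fin n → ℝ) => w.2 ⬝ᵥ v w.1 := by
  simp only [dotProduct]
  refine Finset.measurable_sum _ fun i _ => ?_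
  exact ((measurable_pi_apply i).comp measurable_snd).mul
    ((measurable_of_finite fun u => v u i).comp measurable_fst)

lemma measurable_signal (S : Strategy Ω ι K) (v : ι → Fin n → ℝ) (t : ℕ) :
    Measurable (S.signal v t) := by
  unfold signal
  refine Measurable.ite (measurable_fst (S.measurableSet_explore t)) ?_ measurable_const
  exact measurable_inr.comp ((measurable_fst.comp measurable_snd).prodMk
    ((measurable_dot v).comp measurable_snd))

lemma measurable_step (S : Strategy Ω ι K) (v : ι → Fin n → ℝ) (t : ℕ) :
    Measurable (S.step v t) :=
  (measurable_fst.comp measurable_fst).prodMk ((measurable_snoc t).comp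
    ((measurable_snd.comp measurable_fst).prodMk (S.measurable_signal v t)))

lemma measurable_hist (S : Strategy Ω ι K) (v : ι → Fin n → ℝ) {t : ℕ} (ht : t ≤ T) :
    Measurable (S.hist (T := T) v ht) := by
  induction t with
  | zero => exact measurable_const (a := (Fin.elim0 : Fin 0 → Signal ι))
  | succ t ih =>
    have : S.hist (T := T) v ht = fun p => (S.step v t
        ((p.1, S.hist v (Nat.le_of_succ_le ht) p), p.2 ⟨t, ht⟩)).2 := rfl
    rw [this]
    exact measurable_snd.comp ((S.measurable_step v t).comp
      ((measurable_fst.prodMk (ih _)).prodMk ((measurable_pi_apply _).comp measurable_snd)))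

variable [Nonempty ι]

/-- The law of the seed and of the pairs (exploratory draw, loss), for i.i.d. losses of law `ν`. -/
noncomputable def playLaw (S : Strategy Ω ι K) (ν : Measure (Fin n → ℝ)) (T : ℕ) :
    Measure (Ω × (Fin T → ι × (Fin n → ℝ))) :=
  S.law.prod (Measure.pi fun _ => (unif ι).prod ν)

/-- The law of the seed and of the history of the first `t` rounds, for i.i.d. losses of law
`ν`. -/
noncomputable def obsLaw (S : Strategy Ω ι K) (v : ι → Fin n → ℝ) (ν : Measure (Fin n → ℝ)) :
    (t : ℕ) → Measure (Ω × (Fin t → Signal ι))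
  | 0 => S.law.map fun ω => (ω, Fin.elim0)
  | t + 1 => ((obsLaw S v ν t).prod ((unif ι).prod ν)).map (S.step v t)

instance (S : Strategy Ω ι K) (v : ι → Fin n → ℝ) (ν : Measure (Fin n → ℝ))
    [IsProbabilityMeasure ν] (t : ℕ) : IsProbabilityMeasure (S.obsLaw v ν t) := by
  induction t with
  | zero => exact Measure.isProbabilityMeasure_map (measurable_id.prodMk measurable_const).aemeasurable
  | succ t ih => exact Measure.isProbabilityMeasure_map (S.measurable_step v t).aemeasurable

instance (S : Strategy Ω ι K) (ν : Measure (Fin n → ℝ))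
    [IsProbabilityMeasure ν] (T : ℕ) : IsProbabilityMeasure (S.playLaw ν T) := by
  unfold playLaw; infer_instance

/-- The pair (draw, loss) of a round is independent of the past. -/
lemma map_hist_prod (S : Strategy Ω ι K) (v : ι → Fin n → ℝ) (ν : Measure (Fin n → ℝ))
    [IsProbabilityMeasure ν] (t : Fin T) :
    (S.playLaw ν T).map (fun p => ((p.1, S.hist v t.isLt.le p), p.2 t))
      = ((S.playLaw ν T).map fun p => (p.1, S.hist v t.isLt.le p)).prod ((unif ι).prod ν) := by
  have hh : Measurable fun p : Ω × (Fin T → ι × (Fin n → ℝ)) => (p.1, S.hist v t.isLt.le p) :=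
    measurable_fst.prodMk (S.measurable_hist v _)
  -- Overwriting the pair of round `t` by an independent copy preserves the law of the play and does
  -- not touch the earlier history, which never reads that pair. Independence follows.
  have hpres : MeasurePreserving
      (fun p : (Ω × (Fin T → ι × (Fin n → ℝ))) × (ι × (Fin n → ℝ)) =>
        (p.1.1, Function.update p.1.2 t p.2))
      ((S.playLaw ν T).prod ((unif ι).prod ν)) (S.playLaw ν T) :=
    ((MeasurePreserving.id S.law).prod (measurePreserving_update ((unif ι).prod ν) t)).comp
      (measurePreserving_prodAssoc S.law _ _)
  have hg : Measurable fun p : Ω × (Fin T → ι × (Fin n → ℝ)) =>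
      ((p.1, S.hist v t.isLt.le p), p.2 t) :=
    hh.prodMk ((measurable_pi_apply t).comp measurable_snd)
  conv_lhs => rw [← hpres.map_eq]
  rw [Measure.map_map hg hpres.measurable]
  have : ((fun p : Ω × (Fin T → ι × (Fin n → ℝ)) => ((p.1, S.hist v t.isLt.le p), p.2 t)) ∘
      fun p : (Ω × (Fin T → ι × (Fin n → ℝ))) × (ι × (Fin n → ℝ)) =>
        (p.1.1, Function.update p.1.2 t p.2))
      = Prod.map (fun p => (p.1, S.hist v t.isLt.le p)) id := by
    funext p
    simp only [Function.comp, Prod.map, Function.update_self, id]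
    rw [S.hist_congr v t.isLt.le p.1.1 (Function.update p.1.2 t p.2) p.1.2]
    intro s hs
    rw [Function.update_of_ne (by rintro rfl; exact lt_irrefl _ hs)]
  rw [this, ← Measure.map_prod_map _ _ hh measurable_id, Measure.map_id]

/-- The regret lives on `playLaw`, while the change of measure is an induction along the recursion
of `obsLaw`; this is the bridge between them. -/
lemma map_hist (S : Strategy Ω ι K) (v : ι → Fin n → ℝ) (ν : Measure (Fin n → ℝ))
    [IsProbabilityMeasure ν] {t : ℕ} (ht : t ≤ T) :
    (S.playLaw ν T).map (fun p => (p.1, S.hist v ht p)) = S.obsLaw v ν t := by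
  induction t with
  | zero =>
    have : (fun p : Ω × (Fin T → ι × (Fin n → ℝ)) => (p.1, S.hist v ht p))
        = (fun ω => (ω, (Fin.elim0 : Fin 0 → Signal ι))) ∘ Prod.fst := rfl
    rw [this, ← Measure.map_map (by fun_prop) measurable_fst, playLaw,
      Measure.map_fst_prod]
    simp [obsLaw]
  | succ t ih =>
    have h := S.map_hist_prod v ν ⟨t, ht⟩
    simp only at h
    have : (fun p : Ω × (Fin T → ι × (Fin n → ℝ)) => (p.1, S.hist v ht p))
        = S.step v t ∘ fun p => ((p.1, S.hist v (Nat.le_of_succ_le ht) p), p.2 ⟨t, ht⟩) := rfl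
    rw [this, ← Measure.map_map (S.measurable_step v t), h, ih, obsLaw]
    exact (measurable_fst.prodMk (S.measurable_hist v _)).prodMk
      ((measurable_pi_apply _).comp measurable_snd)

/-! ### Change of measure and Hellinger affinity of histories -/

variable {Ω : Type*} [MeasurableSpace Ω] {ι : Type} [MeasurableSpace ι] {n T : ℕ}
  {K : Set (Fin n → ℝ)}

/-- The likelihood of a history, given the likelihood `ρ` of a signal. -/
noncomputable def likelihood (ρ : Signal ι → ℝ≥0∞) (t : ℕ) (x : Ω × (Fin t → Signal ι)) : ℝ≥0∞ :=
  ∏ s, ρ (x.2 s)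

lemma measurable_likelihood {ρ : Signal ι → ℝ≥0∞} (hρ : Measurable ρ) (t : ℕ) :
    Measurable (likelihood (Ω := Ω) ρ t) :=
  Finset.measurable_prod _ fun s _ => hρ.comp ((measurable_pi_apply s).comp measurable_snd)

lemma likelihood_step (S : Strategy Ω ι K) (v : ι → Fin n → ℝ) (ρ : Signal ι → ℝ≥0∞) (t : ℕ)
    (p : (Ω × (Fin t → Signal ι)) × (ι × (Fin n → ℝ))) :
    likelihood ρ (t + 1) (S.step v t p) = likelihood ρ t p.1 * ρ (S.signal v t p) := by
  simp [likelihood, step, Fin.prod_univ_castSucc]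

variable [Fintype ι] [MeasurableSingletonClass ι]

/-- What a round played from the exploration distribution reveals. -/
def reveal (v : ι → Fin n → ℝ) (w : ι × (Fin n → ℝ)) : Signal ι :=
  Sum.inr (w.1, w.2 ⬝ᵥ v w.1)

lemma measurable_reveal (v : ι → Fin n → ℝ) : Measurable (reveal v) :=
  measurable_inr.comp (measurable_fst.prodMk (measurable_dot v))

/-- The probability that round `t` is played from the exploration distribution. -/
noncomputable def exploreProb (S : Strategy Ω ι K) (v : ι → Fin n → ℝ) (ν : Measure (Fin n → ℝ))
    (t : ℕ) : ℝ≥0∞ :=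
  S.obsLaw v ν t {x | S.explore t x.1 x.2 = true}

lemma lintegral_obsLaw_succ (S : Strategy Ω ι K) (v : ι → Fin n → ℝ) (ν : Measure (Fin n → ℝ))
    [IsProbabilityMeasure ν] (t : ℕ) {F : Ω × (Fin (t + 1) → Signal ι) → ℝ≥0∞}
    (hF : Measurable F) :
    ∫⁻ x, F x ∂S.obsLaw v ν (t + 1)
      = ∫⁻ x, ∫⁻ w, F (S.step v t (x, w)) ∂(unif ι).prod ν ∂S.obsLaw v ν t := by
  have hm : Measurable fun p => F (S.step v t p) := hF.comp (S.measurable_step v t)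
  rw [obsLaw, lintegral_map hF (S.measurable_step v t), lintegral_prod _ hm.aemeasurable]

/-- `ρ` is the likelihood ratio of what an exploratory round reveals, between the loss laws `ν'`
and `ν`, and the Hellinger affinity of the two laws is at least `1 - h`. -/
structure IsLikelihoodRatio (v : ι → Fin n → ℝ) (ν ν' : Measure (Fin n → ℝ))
    (ρ : Signal ι → ℝ≥0∞) (h : ℝ≥0∞) : Prop where
  measurable : Measurable ρ
  silent : ρ (Sum.inl ()) = 1
  change : ∀ G : Signal ι → ℝ≥0∞, Measurable G →
    ∫⁻ w, G (reveal v w) ∂(unif ι).prod ν'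
      = ∫⁻ w, ρ (reveal v w) * G (reveal v w) ∂(unif ι).prod ν
  affinity : 1 ≤ ∫⁻ w, ρ (reveal v w) ^ (1 / 2 : ℝ) ∂(unif ι).prod ν + h

variable [Nonempty ι] {v : ι → Fin n → ℝ} {ν ν' : Measure (Fin n → ℝ)} [IsProbabilityMeasure ν]
  [IsProbabilityMeasure ν'] {ρ : Signal ι → ℝ≥0∞} {h : ℝ≥0∞}

/-- Change of measure for the history. -/
lemma lintegral_obsLaw_eq_likelihood (S : Strategy Ω ι K)
    (H : IsLikelihoodRatio v ν ν' ρ h)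
    (t : ℕ) {F : Ω × (Fin t → Signal ι) → ℝ≥0∞} (hF : Measurable F) :
    ∫⁻ x, F x ∂S.obsLaw v ν' t = ∫⁻ x, likelihood ρ t x * F x ∂S.obsLaw v ν t := by
  have hρ := H.measurable
  induction t with
  | zero =>
    have hm : Measurable fun ω : Ω => (ω, (Fin.elim0 : Fin 0 → Signal ι)) := by fun_prop
    have hLF : Measurable fun x : Ω × (Fin 0 → Signal ι) => likelihood ρ 0 x * F x :=
      (measurable_likelihood hρ 0).mul hF
    simp only [obsLaw]
    rw [lintegral_map hF hm, lintegral_map hLF hm]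
    simp [likelihood]
  | succ t ih =>
    have hL := measurable_likelihood (Ω := Ω) hρ
    have hFs : Measurable fun p => F (S.step v t p) := hF.comp (S.measurable_step v t)
    have hLF : Measurable fun x : Ω × (Fin (t + 1) → Signal ι) => likelihood ρ (t + 1) x * F x :=
      (hL _).mul hF
    rw [S.lintegral_obsLaw_succ v ν' t hF, S.lintegral_obsLaw_succ v ν t hLF,
      ih hFs.lintegral_prod_right']
    refine lintegral_congr fun x => ?_
    simp only [likelihood_step, mul_assoc]
    rw [lintegral_const_mul]
    · congr 1
      -- The decision to explore is a function of the seed and the past, so it contributes no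
      -- likelihood factor of its own; only a revealed signal does.
      by_cases he : S.explore t x.1 x.2 = true
      · simp only [step, signal, he, if_true]
        exact H.change (fun y => F (x.1, Fin.snoc (α := fun _ => Signal ι) x.2 y))
          (hF.comp (measurable_const.prodMk ((measurable_snoc t).comp
            (measurable_const.prodMk measurable_id))))
      · simp [step, signal, he, H.silent]
    · exact ((hρ.comp (S.measurable_signal v t)).comp measurable_prodMk_left).mul
        (hFs.comp measurable_prodMk_left)

lemma sqrt_mul_self (L : ℝ≥0∞) : L ^ (1 / 2 : ℝ) * L ^ (1 / 2 : ℝ) = L := by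
  rw [← ENNReal.rpow_add_of_nonneg _ _ (by norm_num) (by norm_num)]
  norm_num

lemma sqrt_le_add_mul_of_real {a b : NNReal} (hab : ∀ x : ℝ, x ≤ a + b * (x * x)) (hb : b ≠ 0)
    (L : ℝ≥0∞) : L ^ (1 / 2 : ℝ) ≤ a + b * L := by
  conv_rhs => rw [← sqrt_mul_self L]
  generalize L ^ (1 / 2 : ℝ) = s
  rcases eq_or_ne s ∞ with rfl | hL
  · simp [ENNReal.mul_top, hb]
  lift s to NNReal using hL
  exact_mod_cast hab s

lemma sqrt_le_half_add_half_mul (L : ℝ≥0∞) :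
    L ^ (1 / 2 : ℝ) ≤ (2⁻¹ : NNReal) + (2⁻¹ : NNReal) * L :=
  sqrt_le_add_mul_of_real (fun x => by push_cast; nlinarith [sq_nonneg (x - 1)]) (by norm_num) L

/-- This bound and the next are the tangents to the square root at `L = 4` and `L = 1/4`. Weighted
by a test `f` and by `1 - f`, they bound the affinity by `1/2` plus `3/4` of the sum of the two test
errors. -/
lemma sqrt_le_one_add_quarter_mul (L : ℝ≥0∞) :
    L ^ (1 / 2 : ℝ) ≤ (1 : NNReal) + (4⁻¹ : NNReal) * L :=
  sqrt_le_add_mul_of_real (fun x => by push_cast; nlinarith [sq_nonneg (x - 2)]) (by norm_num) L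

lemma sqrt_le_quarter_add (L : ℝ≥0∞) :
    L ^ (1 / 2 : ℝ) ≤ (4⁻¹ : NNReal) + (1 : NNReal) * L :=
  sqrt_le_add_mul_of_real (fun x => by push_cast; nlinarith [sq_nonneg (2 * x - 1)]) (by norm_num) L

/-- The Hellinger affinity of the laws of the history of `t` rounds. -/
noncomputable def affinity (S : Strategy Ω ι K) (v : ι → Fin n → ℝ) (ν : Measure (Fin n → ℝ))
    (ρ : Signal ι → ℝ≥0∞) (t : ℕ) : ℝ≥0∞ :=
  ∫⁻ x, likelihood ρ t x ^ (1 / 2 : ℝ) ∂S.obsLaw v ν t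

/-- A silent round leaves the affinity unchanged, and an explored one loses at most a fraction `h`
of its conditional value. The mean of `√L` on the exploration event is at most the average of the
probabilities of that event under the two laws, because `√L ≤ (1 + L)/2`. -/
lemma affinity_le_succ (S : Strategy Ω ι K) (H : IsLikelihoodRatio v ν ν' ρ h) (t : ℕ) :
    S.affinity v ν ρ t ≤ S.affinity v ν ρ (t + 1)
      + h * ((2⁻¹ : NNReal) * (S.exploreProb v ν t + S.exploreProb v ν' t)) := by
  have hρ := H.measurable
  have hL := measurable_likelihood (Ω := Ω) hρ t
  have hE := S.measurableSet_explore t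
  set E := {x : Ω × (Fin t → Signal ι) | S.explore t x.1 x.2 = true} with hEdef
  have hhalf : ∫⁻ x in E, likelihood ρ t x ^ (1 / 2 : ℝ) ∂S.obsLaw v ν t
      ≤ (2⁻¹ : NNReal) * (S.exploreProb v ν t + S.exploreProb v ν' t) := by
    have hP' : S.exploreProb v ν' t = ∫⁻ x in E, likelihood ρ t x ∂S.obsLaw v ν t := by
      rw [exploreProb, ← hEdef, ← lintegral_indicator_one hE,
        S.lintegral_obsLaw_eq_likelihood H t (measurable_one.indicator hE),
        ← lintegral_indicator hE]
      refine lintegral_congr fun x => ?_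
      by_cases hx : x ∈ E <;> simp [hx]
    calc ∫⁻ x in E, likelihood ρ t x ^ (1 / 2 : ℝ) ∂S.obsLaw v ν t
        ≤ ∫⁻ x in E, ((2⁻¹ : NNReal) + (2⁻¹ : NNReal) * likelihood ρ t x) ∂S.obsLaw v ν t :=
          lintegral_mono fun x => sqrt_le_half_add_half_mul _
      _ = _ := by
          rw [lintegral_add_left measurable_const, lintegral_const_mul _ hL, ← hP']
          simp [exploreProb, ← hEdef, mul_add]
  have hstep : S.affinity v ν ρ t ≤ S.affinity v ν ρ (t + 1)
      + h * ∫⁻ x in E, likelihood ρ t x ^ (1 / 2 : ℝ) ∂S.obsLaw v ν t := by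
    rw [affinity, affinity, S.lintegral_obsLaw_succ v ν t
      ((measurable_likelihood hρ (t + 1)).pow_const _), ← lintegral_indicator hE,
      ← lintegral_const_mul _ ((hL.pow_const _).indicator hE),
      ← lintegral_add_right _ (((hL.pow_const _).indicator hE).const_mul _)]
    refine lintegral_mono fun x => ?_
    simp only [likelihood_step]
    simp_rw [ENNReal.mul_rpow_of_nonneg _ _ (by norm_num : (0 : ℝ) ≤ 1 / 2)]
    have hm : Measurable fun w => ρ (S.signal v t (x, w)) ^ (1 / 2 : ℝ) :=
      ((hρ.comp (S.measurable_signal v t)).comp measurable_prodMk_left).pow_const _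
    rw [lintegral_const_mul _ hm]
    by_cases hx : x ∈ E
    · have hx' : S.explore t x.1 x.2 = true := hx
      simp only [signal, hx', if_true, Set.indicator_of_mem hx]
      calc likelihood ρ t x ^ (1 / 2 : ℝ) = likelihood ρ t x ^ (1 / 2 : ℝ) * 1 := (mul_one _).symm
        _ ≤ likelihood ρ t x ^ (1 / 2 : ℝ) *
            (∫⁻ w, ρ (reveal v w) ^ (1 / 2 : ℝ) ∂(unif ι).prod ν + h) :=
          mul_le_mul_right H.affinity _
        _ = _ := by rw [mul_add, mul_comm h]; rfl
    · have hx' : ¬ S.explore t x.1 x.2 = true := hx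
      simp [signal, hx', H.silent, hx]
  exact hstep.trans (by gcongr)

lemma one_le_affinity_add (S : Strategy Ω ι K) (H : IsLikelihoodRatio v ν ν' ρ h) (t : ℕ) :
    1 ≤ S.affinity v ν ρ t + h * ((2⁻¹ : NNReal) *
      ∑ s ∈ Finset.range t, (S.exploreProb v ν s + S.exploreProb v ν' s)) := by
  induction t with
  | zero =>
    have : S.affinity v ν ρ 0 = 1 := by simp [affinity, likelihood]
    simp [this]
  | succ t ih =>
    refine ih.trans ((add_le_add_left (S.affinity_le_succ H t) _).trans (le_of_eq ?_))
    rw [Finset.sum_range_succ]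
    ring

/-- Two loss laws that are hard to tell apart: no test of the history has small error under
both. -/
lemma two_thirds_le_test (S : Strategy Ω ι K) {h : NNReal} (H : IsLikelihoodRatio v ν ν' ρ h)
    {t : ℕ} {f : Ω × (Fin t → Signal ι) → ℝ} (hf : Measurable f) (hf0 : ∀ x, 0 ≤ f x)
    (hf1 : ∀ x, f x ≤ 1) :
    2 / 3 ≤ ∫ x, f x ∂S.obsLaw v ν t + ∫ x, (1 - f x) ∂S.obsLaw v ν' t
      + 2 / 3 * h * ∑ s ∈ Finset.range t,
        ((S.exploreProb v ν s).toReal + (S.exploreProb v ν' s).toReal) := by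
  have hL := measurable_likelihood (Ω := Ω) H.measurable t
  have hint : ∀ P : Measure (Ω × (Fin t → Signal ι)), IsProbabilityMeasure P → Integrable f P :=
    fun P _ => Integrable.of_bound hf.aestronglyMeasurable 1
      (Filter.Eventually.of_forall fun x => by rw [Real.norm_of_nonneg (hf0 x)]; exact hf1 x)
  have hF : Measurable fun x => ENNReal.ofReal (f x) := hf.ennreal_ofReal
  have hF' : Measurable fun x => ENNReal.ofReal (1 - f x) :=
    (measurable_const.sub hf).ennreal_ofReal
  -- The right side equals `1/2` plus `3/4` of the sum of errors. Inserted into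
  -- `one_le_affinity_add`, this gives the constants `2/3` of the statement.
  have haff : S.affinity v ν ρ t
      ≤ (∫⁻ x, ENNReal.ofReal (f x) ∂S.obsLaw v ν t
          + (4⁻¹ : NNReal) * ∫⁻ x, ENNReal.ofReal (f x) ∂S.obsLaw v ν' t)
        + ((4⁻¹ : NNReal) * ∫⁻ x, ENNReal.ofReal (1 - f x) ∂S.obsLaw v ν t
          + ∫⁻ x, ENNReal.ofReal (1 - f x) ∂S.obsLaw v ν' t) := by
    have hLF : Measurable fun x => likelihood ρ t x * ENNReal.ofReal (f x) := hL.mul hF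
    have hLF' : Measurable fun x => likelihood ρ t x * ENNReal.ofReal (1 - f x) := hL.mul hF'
    have hFL : Measurable fun x => ENNReal.ofReal (f x)
        + (4⁻¹ : NNReal) * (likelihood ρ t x * ENNReal.ofReal (f x)) := hF.add (hLF.const_mul _)
    rw [S.lintegral_obsLaw_eq_likelihood H t hF, S.lintegral_obsLaw_eq_likelihood H t hF',
      ← lintegral_const_mul _ hLF, ← lintegral_const_mul _ hF',
      ← lintegral_add_left hF, ← lintegral_add_right _ hLF',
      ← lintegral_add_left hFL]
    refine lintegral_mono fun x => ?_
    have hone : ENNReal.ofReal (f x) + ENNReal.ofReal (1 - f x) = 1 := by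
      rw [← ENNReal.ofReal_add (hf0 x) (by linarith [hf1 x])]; simp
    calc likelihood ρ t x ^ (1 / 2 : ℝ)
        = likelihood ρ t x ^ (1 / 2 : ℝ) * ENNReal.ofReal (f x)
          + likelihood ρ t x ^ (1 / 2 : ℝ) * ENNReal.ofReal (1 - f x) := by
          rw [← mul_add, hone, mul_one]
      _ ≤ ((1 : NNReal) + (4⁻¹ : NNReal) * likelihood ρ t x) * ENNReal.ofReal (f x)
          + ((4⁻¹ : NNReal) + (1 : NNReal) * likelihood ρ t x) * ENNReal.ofReal (1 - f x) :=
          add_le_add (mul_le_mul_left (sqrt_le_one_add_quarter_mul _) _)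
            (mul_le_mul_left (sqrt_le_quarter_add _) _)
      _ = _ := by simp only [ENNReal.coe_one, one_mul, add_mul, mul_assoc]
  have hI : ∀ P : Measure (Ω × (Fin t → Signal ι)), IsProbabilityMeasure P →
      ∫⁻ x, ENNReal.ofReal (f x) ∂P = ENNReal.ofReal (∫ x, f x ∂P) := fun P hP =>
    (ofReal_integral_eq_lintegral_ofReal (hint P hP) (Filter.Eventually.of_forall hf0)).symm
  have hI' : ∀ P : Measure (Ω × (Fin t → Signal ι)), IsProbabilityMeasure P →
      ∫⁻ x, ENNReal.ofReal (1 - f x) ∂P = ENNReal.ofReal (1 - ∫ x, f x ∂P) := fun P hP => by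
    have hi : Integrable (fun x => 1 - f x) P := (integrable_const 1).sub (hint P hP)
    rw [← ofReal_integral_eq_lintegral_ofReal hi
      (Filter.Eventually.of_forall fun x => by simpa using hf1 x),
      integral_sub (integrable_const 1) (hint P hP)]
    simp
  have hA0 : ∀ P : Measure (Ω × (Fin t → Signal ι)), IsProbabilityMeasure P →
      0 ≤ ∫ x, f x ∂P ∧ ∫ x, f x ∂P ≤ 1 := fun P hP => by
    refine ⟨integral_nonneg hf0, ?_⟩
    calc ∫ x, f x ∂P ≤ ∫ _, (1 : ℝ) ∂P := integral_mono (hint P hP) (integrable_const 1) hf1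
      _ = 1 := by simp
  have hexp : ∀ (ν : Measure (Fin n → ℝ)), IsProbabilityMeasure ν → ∀ s,
      S.exploreProb v ν s = ENNReal.ofReal (S.exploreProb v ν s).toReal := fun ν _ s =>
    (ENNReal.ofReal_toReal (measure_ne_top _ _)).symm
  have hsum : ∑ s ∈ Finset.range t, (S.exploreProb v ν s + S.exploreProb v ν' s)
      = ENNReal.ofReal (∑ s ∈ Finset.range t,
        ((S.exploreProb v ν s).toReal + (S.exploreProb v ν' s).toReal)) := by
    rw [ENNReal.ofReal_sum_of_nonneg fun s _ => by positivity]
    refine Finset.sum_congr rfl fun s _ => ?_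
    rw [ENNReal.ofReal_add (by positivity) (by positivity), ← hexp ν inferInstance,
      ← hexp ν' inferInstance]
  have hmain := (S.one_le_affinity_add H t).trans (add_le_add_left haff _)
  rw [hI _ inferInstance, hI _ inferInstance, hI' _ inferInstance, hI' _ inferInstance, hsum]
    at hmain
  rw [integral_sub (integrable_const 1) (hint _ inferInstance)]
  obtain ⟨ha, ha'⟩ := hA0 (S.obsLaw v ν t) inferInstance
  obtain ⟨hb, hb'⟩ := hA0 (S.obsLaw v ν' t) inferInstance
  set a := ∫ x, f x ∂S.obsLaw v ν t
  set b := ∫ x, f x ∂S.obsLaw v ν' t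
  have hX : 0 ≤ ∑ s ∈ Finset.range t,
      ((S.exploreProb v ν s).toReal + (S.exploreProb v ν' s).toReal) :=
    Finset.sum_nonneg fun s _ => by positivity
  set X := ∑ s ∈ Finset.range t,
      ((S.exploreProb v ν s).toReal + (S.exploreProb v ν' s).toReal)
  have h4 : ((4⁻¹ : NNReal) : ℝ≥0∞) = ENNReal.ofReal (1 / 4) := by
    rw [ENNReal.ofReal, ENNReal.coe_inj]; ext; push_cast; norm_num
  have h2 : ((2⁻¹ : NNReal) : ℝ≥0∞) = ENNReal.ofReal (1 / 2) := by
    rw [ENNReal.ofReal, ENNReal.coe_inj]; ext; push_cast; norm_num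
  rw [h4, h2, ← ENNReal.ofReal_coe_nnreal (p := h), ← ENNReal.ofReal_one,
    ← ENNReal.ofReal_mul (by norm_num), ← ENNReal.ofReal_mul (by norm_num),
    ← ENNReal.ofReal_mul (by norm_num), ← ENNReal.ofReal_mul (by positivity),
    ← ENNReal.ofReal_add ha (by linarith), ← ENNReal.ofReal_add (by linarith) (by linarith),
    ← ENNReal.ofReal_add (by linarith) (by linarith),
    ← ENNReal.ofReal_add (by linarith) (by positivity),
    ENNReal.ofReal_le_ofReal_iff (by have := mul_nonneg h.2 hX; nlinarith)] at hmain
  simp only [integral_const, probReal_univ, smul_eq_mul, mul_one]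
  nlinarith

end Strategy
-- Linear functionals on a bounded action set
lemma abs_dotProduct_le {n : ℕ} (h : Fin n → ℝ) {x : Fin n → ℝ} (hx : ∀ i, |x i| ≤ 1) :
    |h ⬝ᵥ x| ≤ ∑ i, |h i| := by
  refine (Finset.abs_sum_le_sum_abs _ _).trans (Finset.sum_le_sum fun i _ => ?_)
  rw [abs_mul]
  exact mul_le_of_le_one_right (abs_nonneg _) (hx i)

section SInf

variable {n T : ℕ} {K : Set (Fin n → ℝ)}

lemma bddBelow_dotProduct (hK : ∀ x ∈ K, ∀ i, |x i| ≤ 1) (h : Fin n → ℝ) :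
    BddBelow ((fun x => h ⬝ᵥ x) '' K) :=
  ⟨-∑ i, |h i|, by
    rintro _ ⟨x, hx, rfl⟩
    exact (abs_le.1 (abs_dotProduct_le h (hK x hx))).1⟩

lemma abs_sInf_dotProduct_le (hK : ∀ x ∈ K, ∀ i, |x i| ≤ 1) (hne : K.Nonempty)
    (h : Fin n → ℝ) : |sInf ((fun x => h ⬝ᵥ x) '' K)| ≤ ∑ i, |h i| := by
  rw [abs_le]
  constructor
  · refine le_csInf (hne.image _) ?_
    rintro _ ⟨x, hx, rfl⟩
    exact (abs_le.1 (abs_dotProduct_le h (hK x hx))).1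
  · obtain ⟨x, hx⟩ := hne
    exact (csInf_le (bddBelow_dotProduct hK h) ⟨x, hx, rfl⟩).trans
      (abs_le.1 (abs_dotProduct_le h (hK x hx))).2

/-- An infimum of functionals that are all `n`-Lipschitz for the sup distance is `n`-Lipschitz. It
supplies the measurability of the comparator term of the regret. -/
lemma continuous_sInf_dotProduct (hK : ∀ x ∈ K, ∀ i, |x i| ≤ 1) (hne : K.Nonempty) :
    Continuous fun h : Fin n → ℝ => sInf ((fun x => h ⬝ᵥ x) '' K) := by
  refine (LipschitzWith.of_le_add_mul (n : NNReal) fun h h' => ?_).continuous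
  rw [← sub_le_iff_le_add]
  refine le_csInf (hne.image _) ?_
  rintro _ ⟨x, hx, rfl⟩
  have h1 : sInf ((fun x => h ⬝ᵥ x) '' K) ≤ h ⬝ᵥ x :=
    csInf_le (bddBelow_dotProduct hK h) ⟨x, hx, rfl⟩
  have h2 : h ⬝ᵥ x - h' ⬝ᵥ x ≤ n * dist h h' := by
    rw [← sub_dotProduct]
    refine (le_abs_self _).trans ((abs_dotProduct_le _ (hK x hx)).trans ?_)
    refine (Finset.sum_le_card_nsmul _ _ (dist h h') fun i _ => ?_).trans (by simp)
    rw [Pi.sub_apply, ← Real.dist_eq]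
    exact dist_le_pi_dist h h' i
  simp only [NNReal.coe_natCast] at *
  linarith

end SInf

/-! ### Expected regret against i.i.d. losses -/

namespace Strategy

variable {Ω : Type*} [MeasurableSpace Ω] {ι : Type} [MeasurableSpace ι] {n T : ℕ}
  {K : Set (Fin n → ℝ)}

/-- The loss of a round, given the past and the pair (exploratory draw, loss vector). -/
def roundLoss (S : Strategy Ω ι K) (v : ι → Fin n → ℝ) (t : ℕ)
    (p : (Ω × (Fin t → Signal ι)) × (ι × (Fin n → ℝ))) : ℝ :=
  p.2.2 ⬝ᵥ (if S.explore t p.1.1 p.1.2 = true then v p.2.1 else S.action t p.1.1 p.1.2)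

lemma abs_roundLoss_le (S : Strategy Ω ι K) {v : ι → Fin n → ℝ} (hK : ∀ x ∈ K, ∀ i, |x i| ≤ 1)
    (hv : ∀ u i, |v u i| ≤ 1) (t : ℕ) (p : (Ω × (Fin t → Signal ι)) × (ι × (Fin n → ℝ))) :
    |S.roundLoss v t p| ≤ ∑ i, |p.2.2 i| := by
  refine abs_dotProduct_le _ fun i => ?_
  split_ifs
  · exact hv _ _
  · exact hK _ (S.action_mem _ _ _) _

variable [Fintype ι]

/-- The mean of the point played in round `t`, given the past. -/
noncomputable def meanPlayed (S : Strategy Ω ι K) (v : ι → Fin n → ℝ) (t : ℕ)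
    (x : Ω × (Fin t → Signal ι)) : Fin n → ℝ :=
  if S.explore t x.1 x.2 = true then fun i => Finset.univ.expect fun u => v u i
  else S.action t x.1 x.2

lemma measurable_meanPlayed (S : Strategy Ω ι K) (v : ι → Fin n → ℝ) (t : ℕ) :
    Measurable (S.meanPlayed v t) :=
  Measurable.ite (S.measurableSet_explore t) measurable_const (S.measurable_action t)

variable [MeasurableSingletonClass ι]

lemma measurable_roundLoss (S : Strategy Ω ι K) (v : ι → Fin n → ℝ) (t : ℕ) :
    Measurable (S.roundLoss v t) := by
  have : S.roundLoss v t = fun p => if S.explore t p.1.1 p.1.2 = true then p.2.2 ⬝ᵥ v p.2.1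
      else p.2.2 ⬝ᵥ S.action t p.1.1 p.1.2 := by
    funext p; unfold roundLoss; split_ifs <;> rfl
  rw [this]
  refine Measurable.ite (measurable_fst (S.measurableSet_explore t))
    ((measurable_dot v).comp measurable_snd) ?_
  simp only [dotProduct]
  refine Finset.measurable_sum _ fun i _ => ?_
  exact ((measurable_pi_apply i).comp (measurable_snd.comp measurable_snd)).mul
    ((measurable_pi_apply i).comp ((S.measurable_action t).comp measurable_fst))

variable [Nonempty ι] {v : ι → Fin n → ℝ} {ν : Measure (Fin n → ℝ)} [IsProbabilityMeasure ν]

lemma integrable_roundLoss (S : Strategy Ω ι K) (hK : ∀ x ∈ K, ∀ i, |x i| ≤ 1)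
    (hv : ∀ u i, |v u i| ≤ 1) (hν : ∀ i, Integrable (fun h => h i) ν) (t : ℕ) :
    Integrable (S.roundLoss v t) ((S.obsLaw v ν t).prod ((unif ι).prod ν)) := by
  have hg : Integrable (fun p : (Ω × (Fin t → Signal ι)) × (ι × (Fin n → ℝ)) => ∑ i, |p.2.2 i|)
      ((S.obsLaw v ν t).prod ((unif ι).prod ν)) :=
    integrable_finsetSum _ fun i _ => (((hν i).comp_snd _).comp_snd _).abs
  refine hg.mono' (S.measurable_roundLoss v t).aestronglyMeasurable
    (Filter.Eventually.of_forall fun p => ?_)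
  exact S.abs_roundLoss_le hK hv t p

/-- The draw and the loss vector of a round are independent of the past and of each other, so both
may be replaced by their means. -/
lemma integral_roundLoss (S : Strategy Ω ι K) (hK : ∀ x ∈ K, ∀ i, |x i| ≤ 1)
    (hv : ∀ u i, |v u i| ≤ 1) (hν : ∀ i, Integrable (fun h => h i) ν) (t : ℕ) :
    ∫ p, S.roundLoss v t p ∂(S.obsLaw v ν t).prod ((unif ι).prod ν)
      = ∫ x, (fun i => ∫ h, h i ∂ν) ⬝ᵥ S.meanPlayed v t x ∂S.obsLaw v ν t := by
  rw [integral_prod _ (S.integrable_roundLoss hK hv hν t)]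
  refine integral_congr_ae (Filter.Eventually.of_forall fun x => ?_)
  have hdot : ∀ y : Fin n → ℝ, ∫ h, h ⬝ᵥ y ∂ν = (fun i => ∫ h, h i ∂ν) ⬝ᵥ y := fun y => by
    simp only [dotProduct]
    rw [integral_finsetSum _ fun i _ => (hν i).mul_const _]
    simp_rw [integral_mul_const]
  by_cases he : S.explore t x.1 x.2 = true
  · simp only [roundLoss, meanPlayed, he, if_true]
    have hint : Integrable (fun w : ι × (Fin n → ℝ) => w.2 ⬝ᵥ v w.1) ((unif ι).prod ν) := by
      have hg : Integrable (fun w : ι × (Fin n → ℝ) => ∑ i, |w.2 i|) ((unif ι).prod ν) :=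
        integrable_finsetSum _ fun i _ => ((hν i).comp_snd _).abs
      exact hg.mono' (measurable_dot v).aestronglyMeasurable
        (Filter.Eventually.of_forall fun w => abs_dotProduct_le _ (hv _))
    rw [integral_prod _ hint]
    simp only [hdot]
    rw [integral_unif]
    simp only [dotProduct]
    rw [Finset.expect_sum_comm]
    simp_rw [Finset.mul_expect]
  · simp only [roundLoss, meanPlayed, he]
    have := integral_fun_snd (μ := unif ι) (ν := ν) fun h => h ⬝ᵥ S.action t x.1 x.2
    simp only [Bool.false_eq_true, if_false]
    rw [this, hdot]
    simp

/-- The total loss of a play, as a function of the seed and of the pairs (exploratory draw,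
loss). -/
def totalLoss (S : Strategy Ω ι K) (v : ι → Fin n → ℝ)
    (p : Ω × (Fin T → ι × (Fin n → ℝ))) : ℝ :=
  ∑ t : Fin T, S.roundLoss v t ((p.1, S.hist v t.isLt.le p), p.2 t)

lemma integrable_roundLoss_playLaw (S : Strategy Ω ι K) (hK : ∀ x ∈ K, ∀ i, |x i| ≤ 1)
    (hv : ∀ u i, |v u i| ≤ 1) (hν : ∀ i, Integrable (fun h => h i) ν) (t : Fin T) :
    Integrable (fun p => S.roundLoss v t ((p.1, S.hist v t.isLt.le p), p.2 t)) (S.playLaw ν T) ∧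
    ∫ p, S.roundLoss v t ((p.1, S.hist v t.isLt.le p), p.2 t) ∂S.playLaw ν T
      = ∫ x, (fun i => ∫ h, h i ∂ν) ⬝ᵥ S.meanPlayed v t x ∂S.obsLaw v ν t := by
  have hmap : MeasurePreserving (fun p : Ω × (Fin T → ι × (Fin n → ℝ)) =>
      ((p.1, S.hist v t.isLt.le p), p.2 t)) (S.playLaw ν T)
      ((S.obsLaw v ν t).prod ((unif ι).prod ν)) := by
    refine ⟨(measurable_fst.prodMk (S.measurable_hist v _)).prodMk
      ((measurable_pi_apply _).comp measurable_snd), ?_⟩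
    rw [S.map_hist_prod v ν t, S.map_hist v ν t.isLt.le]
  refine ⟨hmap.integrable_comp_of_integrable (S.integrable_roundLoss hK hv hν t), ?_⟩
  rw [← S.integral_roundLoss hK hv hν t, ← hmap.map_eq, integral_map hmap.measurable.aemeasurable
    (S.measurable_roundLoss v t).aestronglyMeasurable]

lemma integrable_totalLoss (S : Strategy Ω ι K) (hK : ∀ x ∈ K, ∀ i, |x i| ≤ 1)
    (hv : ∀ u i, |v u i| ≤ 1) (hν : ∀ i, Integrable (fun h => h i) ν) :
    Integrable (S.totalLoss v) (S.playLaw ν T) :=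
  integrable_finsetSum _ fun t _ => (S.integrable_roundLoss_playLaw hK hv hν t).1

lemma integral_totalLoss (S : Strategy Ω ι K) (hK : ∀ x ∈ K, ∀ i, |x i| ≤ 1)
    (hv : ∀ u i, |v u i| ≤ 1) (hν : ∀ i, Integrable (fun h => h i) ν) :
    ∫ p, S.totalLoss v p ∂S.playLaw ν T
      = ∑ t : Fin T, ∫ x, (fun i => ∫ h, h i ∂ν) ⬝ᵥ S.meanPlayed v t x ∂S.obsLaw v ν t := by
  unfold totalLoss
  rw [integral_finsetSum _ fun t _ => (S.integrable_roundLoss_playLaw hK hv hν t).1]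
  exact Finset.sum_congr rfl fun t _ => (S.integrable_roundLoss_playLaw hK hv hν t).2

lemma measurePreserving_play (S : Strategy Ω ι K) (ν : Measure (Fin n → ℝ))
    [IsProbabilityMeasure ν] (T : ℕ) :
    MeasurePreserving (fun p : (Fin T → Fin n → ℝ) × ((Fin T → ι) × Ω) =>
        (p.2.2, fun t => (p.2.1 t, p.1 t)))
      ((Measure.pi fun _ => ν).prod ((unif (Fin T → ι)).prod S.law)) (S.playLaw ν T) := by
  have h1 : MeasurePreserving (fun p : (Fin T → ι) × (Fin T → Fin n → ℝ) => fun t => (p.1 t, p.2 t))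
      ((unif (Fin T → ι)).prod (Measure.pi fun _ => ν))
      (Measure.pi fun _ => (unif ι).prod ν) := by
    rw [← pi_unif]
    exact (measurePreserving_arrowProdEquivProdArrow ι (Fin n → ℝ) (Fin T) (fun _ => unif ι)
      (fun _ => ν)).symm
  have h2 := (MeasurePreserving.id S.law).prod (h1.comp (Measure.measurePreserving_swap
    (μ := Measure.pi fun _ : Fin T => ν) (ν := unif (Fin T → ι))))
  have h3 := h2.comp (Measure.measurePreserving_swap
    (μ := (Measure.pi fun _ : Fin T => ν).prod (unif (Fin T → ι))) (ν := S.law))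
  exact h3.comp (measurePreserving_prodAssoc (Measure.pi fun _ : Fin T => ν) (unif (Fin T → ι))
    S.law).symm

/-- Fubini in the draws and the seed is applied to a slice at fixed `ℓ` of an integrable function;
such slices are integrable for almost every `ℓ`, which is enough for integrating the regret. -/
lemma regret_eq_ae (S : Strategy Ω ι K) (hK : ∀ x ∈ K, ∀ i, |x i| ≤ 1)
    (hv : ∀ u i, |v u i| ≤ 1) (hν : ∀ i, Integrable (fun h => h i) ν) :
    ∀ᵐ ℓ : Fin T → Fin n → ℝ ∂(Measure.pi fun _ => ν), S.regret v ℓ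
      = ∫ p : (Fin T → ι) × Ω, S.totalLoss v (p.2, fun t => (p.1 t, ℓ t))
          ∂(unif (Fin T → ι)).prod S.law
        - sInf ((fun x => (∑ t, ℓ t) ⬝ᵥ x) '' K) := by
  have hint := (S.measurePreserving_play ν T).integrable_comp_of_integrable
    (S.integrable_totalLoss hK hv hν)
  filter_upwards [hint.prod_right_ae] with ℓ hℓ
  simp only [Function.comp] at hℓ
  rw [integral_prod _ hℓ, integral_unif, regret]
  congr 1
  simp only [sum_dotProduct]

theorem integrable_regret (S : Strategy Ω ι K) (hK : ∀ x ∈ K, ∀ i, |x i| ≤ 1)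
    (hne : K.Nonempty)
    (hv : ∀ u i, |v u i| ≤ 1) (hν : ∀ i, Integrable (fun h => h i) ν) :
    Integrable (fun ℓ : Fin T → Fin n → ℝ => ∫ p : (Fin T → ι) × Ω,
      S.totalLoss v (p.2, fun t => (p.1 t, ℓ t)) ∂(unif (Fin T → ι)).prod S.law)
      (Measure.pi fun _ => ν) ∧
    Integrable (fun ℓ : Fin T → Fin n → ℝ => sInf ((fun x => (∑ t, ℓ t) ⬝ᵥ x) '' K))
      (Measure.pi fun _ => ν) ∧
    Integrable (fun ℓ : Fin T → Fin n → ℝ => S.regret v ℓ) (Measure.pi fun _ => ν) := by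
  have hint := (S.measurePreserving_play ν T).integrable_comp_of_integrable
    (S.integrable_totalLoss hK hv hν)
  have h1 := hint.integral_prod_left
  have hcoord : ∀ (t : Fin T) i, Integrable (fun ℓ : Fin T → Fin n → ℝ => ℓ t i)
      (Measure.pi fun _ => ν) := fun t i =>
    (measurePreserving_eval (fun _ : Fin T => ν) t).integrable_comp_of_integrable (hν i)
  have h2 : Integrable (fun ℓ : Fin T → Fin n → ℝ => sInf ((fun x => (∑ t, ℓ t) ⬝ᵥ x) '' K))
      (Measure.pi fun _ => ν) := by
    have hg : Integrable (fun ℓ : Fin T → Fin n → ℝ => ∑ i, |(∑ t, ℓ t) i|)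
        (Measure.pi fun _ => ν) := by
      refine integrable_finsetSum _ fun i _ => Integrable.abs ?_
      simp only [Finset.sum_apply]
      exact integrable_finsetSum _ fun t _ => hcoord t i
    refine hg.mono' ?_ (Filter.Eventually.of_forall fun ℓ => abs_sInf_dotProduct_le hK hne _)
    exact ((continuous_sInf_dotProduct hK hne).comp (by fun_prop)).aestronglyMeasurable
  exact ⟨h1, h2, (h1.sub h2).congr ((S.regret_eq_ae hK hv hν).mono fun ℓ hℓ => hℓ.symm)⟩

lemma integrable_dotProduct_meanPlayed (S : Strategy Ω ι K) (hK : ∀ x ∈ K, ∀ i, |x i| ≤ 1)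
    (hv : ∀ u i, |v u i| ≤ 1) (θ : Fin n → ℝ) (t : ℕ) :
    Integrable (fun x => θ ⬝ᵥ S.meanPlayed v t x) (S.obsLaw v ν t) := by
  refine Integrable.of_bound (C := ∑ i, |θ i|) ?_ (Filter.Eventually.of_forall fun x => ?_)
  · refine Measurable.aestronglyMeasurable ?_
    simp only [dotProduct]
    exact Finset.measurable_sum _ fun i _ =>
      ((measurable_pi_apply i).comp (S.measurable_meanPlayed v t)).const_mul _
  · refine abs_dotProduct_le _ fun i => ?_
    unfold meanPlayed
    split_ifs
    · refine (Finset.abs_expect_le _ _).trans ?_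
      exact Finset.expect_le Finset.univ_nonempty fun u _ => hv u i
    · exact hK _ (S.action_mem _ _ _) _

/-- Regret against i.i.d. losses is at least the regret against the mean loss. -/
theorem sum_integral_le_integral_regret (S : Strategy Ω ι K) (hK : ∀ x ∈ K, ∀ i, |x i| ≤ 1)
    (hv : ∀ u i, |v u i| ≤ 1) (hν : ∀ i, Integrable (fun h => h i) ν) {θ y : Fin n → ℝ}
    (hθ : ∀ i, ∫ h, h i ∂ν = θ i) (hy : y ∈ K) :
    ∑ t ∈ Finset.range T, ∫ x, (θ ⬝ᵥ S.meanPlayed v t x - θ ⬝ᵥ y) ∂S.obsLaw v ν t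
      ≤ ∫ ℓ : Fin T → Fin n → ℝ, S.regret v ℓ ∂(Measure.pi fun _ => ν) := by
  obtain ⟨h1, h2, h3⟩ := S.integrable_regret (T := T) hK ⟨y, hy⟩ hv hν
  have hθ' : (fun i => ∫ h, h i ∂ν) = θ := funext hθ
  have hcoord : ∀ (t : Fin T) i, Integrable (fun ℓ : Fin T → Fin n → ℝ => ℓ t i)
      (Measure.pi fun _ => ν) := fun t i =>
    (measurePreserving_eval (fun _ : Fin T => ν) t).integrable_comp_of_integrable (hν i)
  have hcoordint : ∀ (t : Fin T) i, ∫ ℓ : Fin T → Fin n → ℝ, ℓ t i ∂(Measure.pi fun _ => ν)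
      = θ i := fun t i => by
    rw [← hθ i]
    conv_rhs => rw [← (measurePreserving_eval (fun _ : Fin T => ν) t).map_eq]
    rw [integral_map (measurable_pi_apply t).aemeasurable
      (measurable_pi_apply i).aestronglyMeasurable]
  have hdotint : Integrable (fun ℓ : Fin T → Fin n → ℝ => (∑ t, ℓ t) ⬝ᵥ y)
      (Measure.pi fun _ => ν) := by
    simp only [dotProduct, Finset.sum_apply]
    exact integrable_finsetSum _ fun i _ =>
      (integrable_finsetSum _ fun t _ => hcoord t i).mul_const _
  have hdot : ∫ ℓ : Fin T → Fin n → ℝ, (∑ t, ℓ t) ⬝ᵥ y ∂(Measure.pi fun _ => ν)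
      = T * (θ ⬝ᵥ y) := by
    simp only [dotProduct, Finset.sum_apply]
    rw [integral_finsetSum _ fun i _ =>
      (integrable_finsetSum _ fun t _ => hcoord t i).mul_const _, Finset.mul_sum]
    refine Finset.sum_congr rfl fun i _ => ?_
    rw [integral_mul_const, integral_finsetSum _ fun t _ => hcoord t i]
    simp [hcoordint, mul_assoc]
  -- The expectation of a minimum is at most the expected value at the fixed comparator `y`.
  have hlow : ∫ ℓ : Fin T → Fin n → ℝ, sInf ((fun x => (∑ t, ℓ t) ⬝ᵥ x) '' K)
      ∂(Measure.pi fun _ => ν) ≤ T * (θ ⬝ᵥ y) := by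
    rw [← hdot]
    exact integral_mono h2 hdotint fun ℓ => csInf_le (bddBelow_dotProduct hK _) ⟨y, hy, rfl⟩
  have hint := (S.measurePreserving_play ν T).integrable_comp_of_integrable
    (S.integrable_totalLoss hK hv hν)
  have htot : ∫ ℓ : Fin T → Fin n → ℝ, ∫ p : (Fin T → ι) × Ω,
      S.totalLoss v (p.2, fun t => (p.1 t, ℓ t)) ∂(unif (Fin T → ι)).prod S.law
      ∂(Measure.pi fun _ => ν) = ∫ p, S.totalLoss v p ∂S.playLaw ν T := by
    have := integral_prod _ hint
    simp only [Function.comp] at this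
    rw [← this]
    conv_rhs => rw [← (S.measurePreserving_play ν T).map_eq]
    rw [integral_map (S.measurePreserving_play ν T).measurable.aemeasurable]
    rw [(S.measurePreserving_play ν T).map_eq]
    exact (S.integrable_totalLoss hK hv hν).aestronglyMeasurable
  rw [integral_congr_ae (S.regret_eq_ae hK hv hν), integral_sub h1 h2, htot,
    S.integral_totalLoss hK hv hν, hθ', Finset.sum_range]
  have hmp := fun t => S.integrable_dotProduct_meanPlayed (v := v) hK hv (ν := ν) θ t
  have : ∀ t : Fin T, ∫ x, (θ ⬝ᵥ S.meanPlayed v t x - θ ⬝ᵥ y) ∂S.obsLaw v ν t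
      = ∫ x, θ ⬝ᵥ S.meanPlayed v t x ∂S.obsLaw v ν t - θ ⬝ᵥ y := fun t => by
    rw [integral_sub (hmp t) (integrable_const _)]
    simp
  simp only [this, Finset.sum_sub_distrib, Finset.sum_const, Finset.card_univ, Fintype.card_fin,
    nsmul_eq_mul]
  linarith

end Strategy
-- Exploration from a signed basis and the change of one coordinate
/-- The exploratory actions are signed canonical basis vectors, every coordinate being hit
equally often. -/
structure IsSignedBasis {ι : Type} [Fintype ι] {n : ℕ} (v : ι → Fin n → ℝ) (coord : ι → Fin n)
    (sgn : ι → ℝ) : Prop where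
  eq_single : ∀ u, v u = Pi.single (coord u) (sgn u)
  sgn_mul_self : ∀ u, sgn u * sgn u = 1
  card_fiber : ∀ j, (Finset.univ.filter fun u => coord u = j).card * n = Fintype.card ι

section

variable {ι : Type} [Fintype ι] {n : ℕ} {v : ι → Fin n → ℝ} {coord : ι → Fin n} {sgn : ι → ℝ}

lemma IsSignedBasis.dotProduct_eq (hv : IsSignedBasis v coord sgn) (u : ι) (h : Fin n → ℝ) :
    h ⬝ᵥ v u = sgn u * h (coord u) := by
  rw [hv.eq_single, dotProduct_single, mul_comm]

lemma IsSignedBasis.abs_le_one (hv : IsSignedBasis v coord sgn) (u : ι) (i : Fin n) :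
    |v u i| ≤ 1 := by
  rw [hv.eq_single]
  by_cases h : i = coord u
  · subst h
    rw [Pi.single_eq_same, abs_le_one_iff_mul_self_le_one, hv.sgn_mul_self]
  · simp [Pi.single_eq_of_ne h]

end

section

variable {ι : Type} [MeasurableSpace ι] [Fintype ι] [MeasurableSingletonClass ι]
  {n : ℕ} {v : ι → Fin n → ℝ} {coord : ι → Fin n} {sgn : ι → ℝ}

lemma lintegral_reveal (hv : IsSignedBasis v coord sgn) (κ : Fin n → Measure ℝ)
    [∀ i, IsProbabilityMeasure (κ i)] {G : Signal ι → ℝ≥0∞} (hG : Measurable G) :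
    ∫⁻ w, G (Strategy.reveal v w) ∂(unif ι).prod (Measure.pi κ)
      = (Fintype.card ι : ℝ≥0∞)⁻¹ * ∑ u, ∫⁻ y, G (Sum.inr (u, sgn u * y)) ∂κ (coord u) := by
  have hm : Measurable fun w => G (Strategy.reveal v w) := hG.comp (Strategy.measurable_reveal v)
  rw [lintegral_prod _ hm.aemeasurable, lintegral_unif]
  congr 1
  refine Finset.sum_congr rfl fun u _ => ?_
  simp only [Strategy.reveal, hv.dotProduct_eq]
  have hg : Measurable fun y => G (Sum.inr (u, sgn u * y)) :=
    hG.comp (measurable_inr.comp (measurable_const.prodMk (measurable_const.mul measurable_id)))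
  exact (measurePreserving_eval κ (coord u)).lintegral_comp hg

/-- The likelihood ratio of a signal when the law of coordinate `j` of the loss is changed by the
density `r`. -/
noncomputable def coordLikelihood (coord : ι → Fin n) (sgn : ι → ℝ) (j : Fin n) (r : ℝ → ℝ≥0∞) :
    Signal ι → ℝ≥0∞ :=
  Sum.elim (fun _ => 1) fun p => if coord p.1 = j then r (sgn p.1 * p.2) else 1

lemma measurable_coordLikelihood (j : Fin n) {r : ℝ → ℝ≥0∞} (hr : Measurable r) :
    Measurable (coordLikelihood coord sgn j r) := by
  refine measurable_fun_sum measurable_const ?_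
  refine Measurable.ite ?_ (hr.comp ?_) measurable_const
  · exact measurable_fst (Set.toFinite {u | coord u = j}).measurableSet
  · exact ((measurable_of_finite sgn).comp measurable_fst).mul measurable_snd

/-- Only draws that hit `j` see the change, a fraction `1/n` of all by `card_fiber`, so an affinity
defect `h` in one coordinate becomes `h/n` for a round. The signal shows that coordinate up to the
sign of the draw, and a second multiplication by the sign removes it. -/
lemma isLikelihoodRatio_coordLikelihood [Nonempty ι] (hv : IsSignedBasis v coord sgn) {κ κ' : Fin n → Measure ℝ}
    [∀ i, IsProbabilityMeasure (κ i)] [∀ i, IsProbabilityMeasure (κ' i)] {j : Fin n}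
    {r : ℝ → ℝ≥0∞} (hr : Measurable r) (hne : ∀ i, i ≠ j → κ' i = κ i)
    (hj : κ' j = (κ j).withDensity r) {h : NNReal}
    (haff : 1 ≤ ∫⁻ y, r y ^ (1 / 2 : ℝ) ∂κ j + h) :
    Strategy.IsLikelihoodRatio v (Measure.pi κ) (Measure.pi κ') (coordLikelihood coord sgn j r)
      ((h / n : NNReal) : ℝ≥0∞) where
  measurable := measurable_coordLikelihood j hr
  silent := rfl
  change G hG := by
    have hρ := measurable_coordLikelihood (coord := coord) (sgn := sgn) j hr
    have hρG : Measurable fun s => coordLikelihood coord sgn j r s * G s := hρ.mul hG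
    rw [lintegral_reveal hv κ' hG, lintegral_reveal hv κ hρG]
    congr 1
    refine Finset.sum_congr rfl fun u _ => ?_
    have hg : Measurable fun y => G (Sum.inr (u, sgn u * y)) :=
      hG.comp (measurable_inr.comp (measurable_const.prodMk (measurable_const.mul measurable_id)))
    by_cases hu : coord u = j
    · rw [hu, hj, lintegral_withDensity_eq_lintegral_mul _ hr hg]
      refine lintegral_congr fun y => ?_
      simp [coordLikelihood, hu, ← mul_assoc, hv.sgn_mul_self]
    · simp [coordLikelihood, hu, hne _ hu]
  affinity := by
    have hρ := (measurable_coordLikelihood (coord := coord) (sgn := sgn) j hr).pow_const (1 / 2 : ℝ)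
    rw [lintegral_reveal hv κ hρ]
    have hn : (n : ℝ≥0∞) ≠ 0 := Nat.cast_ne_zero.2 (Fin.pos j).ne'
    have hc : (Fintype.card ι : ℝ≥0∞) ≠ 0 := by simp
    have hterm : ∀ u, (1 : ℝ≥0∞) ≤ (∫⁻ y, coordLikelihood coord sgn j r
        (Sum.inr (u, sgn u * y)) ^ (1 / 2 : ℝ) ∂κ (coord u)) + if coord u = j then (h : ℝ≥0∞) else 0 := by
      intro u
      by_cases hu : coord u = j
      · simpa [coordLikelihood, hu, ← mul_assoc, hv.sgn_mul_self] using haff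
      · simp [coordLikelihood, hu]
    have hh : ((h / n : NNReal) : ℝ≥0∞)
        = (Fintype.card ι : ℝ≥0∞)⁻¹ * ∑ u, if coord u = j then (h : ℝ≥0∞) else 0 := by
      rw [← Finset.sum_filter, Finset.sum_const, nsmul_eq_mul, ← hv.card_fiber j,
        ENNReal.coe_div (by exact_mod_cast hn), ENNReal.div_eq_inv_mul, Nat.cast_mul,
        ENNReal.mul_inv (Or.inr (by simp)) (Or.inr hn), mul_mul_mul_comm]
      have hf : ((Finset.univ.filter fun u => coord u = j).card : ℝ≥0∞) ≠ 0 := by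
        intro h0
        have := hv.card_fiber j
        rw [Nat.cast_eq_zero] at h0
        rw [h0, zero_mul] at this
        exact Fintype.card_ne_zero this.symm
      rw [ENNReal.inv_mul_cancel hf (by simp), one_mul]
      simp
    rw [hh, ← mul_add, ← Finset.sum_add_distrib]
    calc (1 : ℝ≥0∞) = (Fintype.card ι : ℝ≥0∞)⁻¹ * ∑ _u : ι, 1 := by
          simp [ENNReal.inv_mul_cancel hc]
      _ ≤ _ := mul_le_mul_right (Finset.sum_le_sum fun u _ => hterm u) _

end

lemma isSignedBasis_basisVec (n : ℕ) :
    IsSignedBasis (basisVec (n := n)) id fun _ => 1 where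
  eq_single _ := rfl
  sgn_mul_self _ := one_mul 1
  card_fiber j := by simp [Finset.filter_eq']

lemma isSignedBasis_signedBasisVec (n : ℕ) :
    IsSignedBasis (signedBasisVec (n := n)) Prod.fst fun u => if u.2 = true then 1 else -1 where
  eq_single u := by
    unfold signedBasisVec basisVec
    split_ifs
    · rfl
    · rw [Pi.single_neg]
  sgn_mul_self u := by split_ifs <;> norm_num
  card_fiber j := by
    have : (Finset.univ.filter fun u : Fin n × Bool => u.1 = j) = {j} ×ˢ Finset.univ := by
      ext u; simp only [Finset.mem_filter, Finset.mem_univ, true_and, Finset.mem_product,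
        Finset.mem_singleton, and_true]
    rw [this]
    simp [mul_comm]

lemma expect_basisVec {n : ℕ} (i : Fin n) :
    (Finset.univ.expect fun u : Fin n => basisVec u i) = 1 / n := by
  rw [Fintype.expect_eq_sum_div_card]
  simp [basisVec, Pi.single_apply]

lemma expect_signedBasisVec {n : ℕ} (i : Fin n) :
    (Finset.univ.expect fun u : Fin n × Bool => signedBasisVec u i) = 0 := by
  rw [Fintype.expect_eq_sum_div_card, Fintype.sum_prod_type]
  simp [signedBasisVec]

/-! ### Tests and regret summed over the rounds -/

namespace Strategy

variable {Ω : Type*} [MeasurableSpace Ω] {ι : Type} [MeasurableSpace ι] {n T : ℕ}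
  {K : Set (Fin n → ℝ)} [Fintype ι] {v : ι → Fin n → ℝ}

/-- The expected number of rounds among the first `T` that are played from the exploration
distribution. -/
noncomputable def exploreCount (S : Strategy Ω ι K) (v : ι → Fin n → ℝ)
    (ν : Measure (Fin n → ℝ)) (T : ℕ) : ℝ :=
  ∑ t ∈ Finset.range T, (S.exploreProb v ν t).toReal

lemma exploreCount_nonneg (S : Strategy Ω ι K) (v : ι → Fin n → ℝ)
    (ν : Measure (Fin n → ℝ)) (T : ℕ) : 0 ≤ S.exploreCount v ν T :=
  Finset.sum_nonneg fun _ _ => ENNReal.toReal_nonneg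

lemma exploreCount_mono (S : Strategy Ω ι K) (v : ι → Fin n → ℝ)
    (ν : Measure (Fin n → ℝ)) {t : ℕ} (ht : t ≤ T) :
    S.exploreCount v ν t ≤ S.exploreCount v ν T :=
  Finset.sum_le_sum_of_subset_of_nonneg (Finset.range_mono ht)
    fun _ _ _ => ENNReal.toReal_nonneg

variable [MeasurableSingletonClass ι] [Nonempty ι]

/-- Testing between two loss laws in each of `T` rounds. -/
lemma sum_test_ge (S : Strategy Ω ι K) {ν ν' : Measure (Fin n → ℝ)} [IsProbabilityMeasure ν]
    [IsProbabilityMeasure ν'] {ρ : Signal ι → ℝ≥0∞} {h : NNReal}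
    (H : IsLikelihoodRatio v ν ν' ρ h) {f : (t : ℕ) → Ω × (Fin t → Signal ι) → ℝ}
    (hf : ∀ t, Measurable (f t)) (hf0 : ∀ t x, 0 ≤ f t x) (hf1 : ∀ t x, f t x ≤ 1) :
    2 / 3 * T ≤ ∑ t ∈ Finset.range T, ∫ x, f t x ∂S.obsLaw v ν t
      + ∑ t ∈ Finset.range T, ∫ x, (1 - f t x) ∂S.obsLaw v ν' t
      + T * (2 / 3 * h * (S.exploreCount v ν T + S.exploreCount v ν' T)) := by
  have hsum : ∑ t ∈ Finset.range T, (2 / 3 : ℝ) ≤ ∑ t ∈ Finset.range T,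
      (∫ x, f t x ∂S.obsLaw v ν t + ∫ x, (1 - f t x) ∂S.obsLaw v ν' t
        + 2 / 3 * h * (S.exploreCount v ν T + S.exploreCount v ν' T)) := by
    refine Finset.sum_le_sum fun t ht => ?_
    refine (S.two_thirds_le_test H (hf t) (hf0 t) (hf1 t)).trans ?_
    have ht' : t ≤ T := (Finset.mem_range.1 ht).le
    rw [Finset.sum_add_distrib]
    -- The counts up to `t` are enlarged to counts up to `T`: one information budget serves all
    -- rounds.
    have h1 := S.exploreCount_mono v ν ht'
    have h2 := S.exploreCount_mono v ν' ht'
    simp only [exploreCount] at h1 h2 ⊢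
    gcongr
  simp only [Finset.sum_add_distrib, Finset.sum_const, Finset.card_range, nsmul_eq_mul] at hsum
  linarith

/-- A pointwise lower bound on the expected regret of each round bounds the total regret. -/
lemma exploreCount_add_le_integral_regret (S : Strategy Ω ι K) {ν : Measure (Fin n → ℝ)}
    [IsProbabilityMeasure ν] (hK : ∀ x ∈ K, ∀ i, |x i| ≤ 1)
    (hv : ∀ u i, |v u i| ≤ 1) (hν : ∀ i, Integrable (fun h => h i) ν) {θ y : Fin n → ℝ}
    (hθ : ∀ i, ∫ h, h i ∂ν = θ i) (hy : y ∈ K) {c : ℝ}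
    {g : (t : ℕ) → Ω × (Fin t → Signal ι) → ℝ} (hg : ∀ t, Integrable (g t) (S.obsLaw v ν t))
    (hle : ∀ t x, (if S.explore t x.1 x.2 = true then c else 0) + g t x
      ≤ θ ⬝ᵥ S.meanPlayed v t x - θ ⬝ᵥ y) :
    c * S.exploreCount v ν T + ∑ t ∈ Finset.range T, ∫ x, g t x ∂S.obsLaw v ν t
      ≤ ∫ ℓ : Fin T → Fin n → ℝ, S.regret v ℓ ∂(Measure.pi fun _ => ν) := by
  refine le_trans ?_ (S.sum_integral_le_integral_regret hK hv hν hθ hy)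
  rw [exploreCount, Finset.mul_sum, ← Finset.sum_add_distrib]
  refine Finset.sum_le_sum fun t _ => ?_
  have hE := S.measurableSet_explore t
  have hi : Integrable (fun x : Ω × (Fin t → Signal ι) =>
      if S.explore t x.1 x.2 = true then c else 0) (S.obsLaw v ν t) := by
    refine Integrable.of_bound (C := |c|) (Measurable.ite hE measurable_const
      measurable_const).aestronglyMeasurable (Filter.Eventually.of_forall fun x => ?_)
    split_ifs <;> simp
  have hint : ∫ x : Ω × (Fin t → Signal ι), (if S.explore t x.1 x.2 = true then c else 0)
      ∂S.obsLaw v ν t = c * (S.exploreProb v ν t).toReal := by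
    have := integral_indicator_const (μ := S.obsLaw v ν t) c hE
    rw [smul_eq_mul, mul_comm] at this
    rw [exploreProb, ← measureReal_def, ← this]
    simp only [Set.indicator_apply, Set.mem_ofPred_eq]
  rw [← hint, ← integral_add hi (hg t)]
  exact integral_mono (hi.add (hg t))
    ((S.integrable_dotProduct_meanPlayed hK hv θ t).sub (integrable_const _)) (hle t)

end Strategy

section ProductLaw

variable {n : ℕ} (κ : Fin n → Measure ℝ) [∀ i, IsProbabilityMeasure (κ i)]

lemma integrable_eval_pi {i : Fin n} (hi : Integrable (fun y => y) (κ i)) :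
    Integrable (fun h : Fin n → ℝ => h i) (Measure.pi κ) :=
  (measurePreserving_eval κ i).integrable_comp_of_integrable hi

lemma integral_eval_pi (i : Fin n) (g : ℝ → ℝ) (hg : Measurable g) :
    ∫ h : Fin n → ℝ, g (h i) ∂Measure.pi κ = ∫ y, g y ∂κ i := by
  conv_rhs => rw [← (measurePreserving_eval κ i).map_eq]
  rw [integral_map (measurable_pi_apply i).aemeasurable hg.aestronglyMeasurable]

lemma ae_pi_of_ae {P : ℝ → Prop} (h : ∀ i, ∀ᵐ y ∂κ i, P y) :
    ∀ᵐ h ∂Measure.pi κ, ∀ i, P (h i) :=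
  ae_all_iff.2 fun i => (measurePreserving_eval κ i).quasiMeasurePreserving.ae (h i)

end ProductLaw

/-! ### The needle in a haystack -/

/-- If the total regret is at least `c` times the number of exploratory rounds plus `ε` times the
number of rounds that miss the best coordinate, and the best coordinate is hard to detect, then the
regret is of order `ε T` for some position of the best coordinate. -/
lemma needle_of_sums {ι : Type*} {J : Finset ι} (hJ : 2 ≤ J.card) {T ε c h X₀ R₀ : ℝ}
    {X R A F : ι → ℝ} (hε : 0 ≤ ε) (hT : 0 ≤ T) (hX₀ : 0 ≤ X₀)
    (hX : ∀ j, 0 ≤ X j) (hc : 2 / 3 * h * T * ε ≤ c) (hF : ∑ j ∈ J, F j ≤ T)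
    (htest : ∀ j ∈ J, 2 / 3 * T ≤ F j + A j + T * (2 / 3 * h * (X₀ + X j)))
    (hR₀ : c * X₀ ≤ R₀) (hR : ∀ j ∈ J, c * X j + ε * A j ≤ R j) :
    ε * T / 12 ≤ R₀ ∨ ∃ j ∈ J, ε * T / 12 ≤ R j := by
  by_contra! hcon
  obtain ⟨h0, h1⟩ := hcon
  have hm : (2 : ℝ) ≤ J.card := by exact_mod_cast hJ
  have hsum : ∑ j ∈ J, (ε * (2 / 3 * T)) ≤ ∑ j ∈ J, (ε * F j + (R j - c * X j) + c * (X₀ + X j)) := by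
    refine Finset.sum_le_sum fun j hj => ?_
    have h2 := mul_le_mul_of_nonneg_left (htest j hj) hε
    have h3 := hR j hj
    -- By `hc`, the cost of the explored rounds dominates the regret that their information could
    -- save.
    have h4 := mul_le_mul_of_nonneg_right hc (add_nonneg hX₀ (hX j))
    linarith
  have hsum3 : ∑ j ∈ J, (ε * F j + (R j - c * X j) + c * (X₀ + X j))
      < ε * T + ∑ j ∈ J, (ε * T / 12 + ε * T / 12) := by
    have : ∑ j ∈ J, (ε * F j + (R j - c * X j) + c * (X₀ + X j))
        = ε * ∑ j ∈ J, F j + ∑ j ∈ J, (R j + c * X₀) := by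
      rw [Finset.mul_sum, ← Finset.sum_add_distrib]
      exact Finset.sum_congr rfl fun j _ => by ring
    rw [this]
    refine add_lt_add_of_le_of_lt (mul_le_mul_of_nonneg_left hF hε)
      (Finset.sum_lt_sum_of_nonempty (Finset.card_pos.1 (by omega)) fun j hj => ?_)
    linarith [h1 j hj]
  simp only [Finset.sum_const, nsmul_eq_mul] at hsum hsum3
  -- With `m = J.card`, the two sums give `(2/3) m εT < εT + (1/6) m εT`, that is `m εT < 2 εT`,
  -- against `2 ≤ m`. This is where `1/12` comes from.
  have := mul_le_mul_of_nonneg_right hm (mul_nonneg hε hT)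
  nlinarith

/-! ### Random signs -/

/-- The law of a random sign that is `-1` with probability `p`. -/
noncomputable def signLaw (p : ℝ) : Measure ℝ :=
  ENNReal.ofReal p • Measure.dirac (-1) + ENNReal.ofReal (1 - p) • Measure.dirac 1

lemma isProbabilityMeasure_signLaw {p : ℝ} (h0 : 0 ≤ p) (h1 : p ≤ 1) :
    IsProbabilityMeasure (signLaw p) where
  measure_univ := by
    simp [signLaw, ← ENNReal.ofReal_add h0 (sub_nonneg.2 h1)]

lemma lintegral_signLaw (p : ℝ) (f : ℝ → ℝ≥0∞) :
    ∫⁻ y, f y ∂signLaw p = ENNReal.ofReal p * f (-1) + ENNReal.ofReal (1 - p) * f 1 := by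
  simp [signLaw, lintegral_add_measure, lintegral_smul_measure]

lemma ae_abs_le_one_signLaw (p : ℝ) : ∀ᵐ y ∂signLaw p, |y| ≤ 1 := by
  rw [signLaw, ae_add_measure_iff]
  constructor <;> refine Measure.ae_smul_measure ?_ _ <;>
    · rw [ae_dirac_iff (measurableSet_le (by fun_prop) (by fun_prop))]; simp

lemma integral_signLaw {p : ℝ} (h0 : 0 ≤ p) (h1 : p ≤ 1) :
    ∫ y, y ∂signLaw p = 1 - 2 * p := by
  have hi : ∀ (c : ℝ) (a : ℝ), Integrable (fun y : ℝ => y) (ENNReal.ofReal c • Measure.dirac a) :=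
    fun c a => (integrable_dirac (by simp)).smul_measure ENNReal.ofReal_ne_top
  rw [signLaw, integral_add_measure (hi _ _) (hi _ _), integral_smul_measure,
    integral_smul_measure]
  simp only [integral_dirac, smul_eq_mul, ENNReal.toReal_ofReal h0,
    ENNReal.toReal_ofReal (sub_nonneg.2 h1)]
  ring

/-- The density of `signLaw p'` with respect to `signLaw p`. -/
noncomputable def signDensity (p p' : ℝ) (y : ℝ) : ℝ≥0∞ :=
  if y = -1 then ENNReal.ofReal (p' / p) else ENNReal.ofReal ((1 - p') / (1 - p))

lemma measurable_signDensity (p p' : ℝ) : Measurable (signDensity p p') :=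
  Measurable.ite (measurableSet_singleton (-1)) measurable_const measurable_const

lemma signLaw_eq_withDensity {p p' : ℝ} (h0 : 0 < p) (h1 : p < 1) :
    signLaw p' = (signLaw p).withDensity (signDensity p p') := by
  ext s hs
  rw [withDensity_apply _ hs, ← lintegral_indicator hs, lintegral_signLaw,
    ← lintegral_indicator_one hs, lintegral_signLaw]
  congr 1
  · by_cases h : (-1 : ℝ) ∈ s
    · simp only [Set.indicator_of_mem h, signDensity, if_true, Pi.one_apply, mul_one]
      rw [← ENNReal.ofReal_mul h0.le, mul_div_cancel₀ _ h0.ne']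
    · simp [h]
  · by_cases h : (1 : ℝ) ∈ s
    · have h2 : (1 : ℝ) ≠ -1 := by norm_num
      simp only [Set.indicator_of_mem h, signDensity, h2, if_false, Pi.one_apply, mul_one]
      rw [← ENNReal.ofReal_mul (by linarith), mul_div_cancel₀ _ (by linarith)]
    · simp [h]

/-- With `a = s²` the difference of the two sides is `(s - 1)² s (s + 2) / 2`. Averaged over a
likelihood ratio, the bound says that the affinity is at least `1 - χ²/2`. -/
lemma sqrt_ge_quadratic {a : ℝ} (ha : 0 ≤ a) : (1 + a) / 2 - (a - 1) ^ 2 / 2 ≤ √a := by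
  obtain ⟨s, hs, rfl⟩ : ∃ s, 0 ≤ s ∧ a = s ^ 2 := ⟨√a, Real.sqrt_nonneg _, (Real.sq_sqrt ha).symm⟩
  rw [Real.sqrt_sq hs]
  nlinarith [mul_nonneg (sq_nonneg (s - 1)) (mul_nonneg hs (by linarith : (0 : ℝ) ≤ s + 2))]

/-- The left side of `hh` is half the `χ²` divergence of the two sign laws. -/
lemma one_le_affinity_signLaw {p p' : ℝ} (h0 : 0 < p) (h1 : p < 1) (h0' : 0 ≤ p') (h1' : p' ≤ 1)
    {h : NNReal} (hh : (p' - p) ^ 2 / 2 * (1 / p + 1 / (1 - p)) ≤ h) :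
    1 ≤ ∫⁻ y, signDensity p p' y ^ (1 / 2 : ℝ) ∂signLaw p + h := by
  have h2 : (1 : ℝ) ≠ -1 := by norm_num
  have hq : 0 < 1 - p := by linarith
  have ha : 0 ≤ p' / p := by positivity
  have hb : 0 ≤ (1 - p') / (1 - p) := div_nonneg (by linarith) hq.le
  rw [lintegral_signLaw]
  simp only [signDensity, h2, if_true, if_false]
  rw [ENNReal.ofReal_rpow_of_nonneg ha (by norm_num), ENNReal.ofReal_rpow_of_nonneg hb (by norm_num),
    ← Real.sqrt_eq_rpow, ← Real.sqrt_eq_rpow, ← ENNReal.ofReal_mul h0.le,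
    ← ENNReal.ofReal_mul hq.le, ← ENNReal.ofReal_coe_nnreal (p := h),
    ← ENNReal.ofReal_add (by positivity) (by positivity),
    ← ENNReal.ofReal_add (by positivity) (by positivity), ← ENNReal.ofReal_one]
  refine ENNReal.ofReal_le_ofReal ?_
  have e1 := mul_le_mul_of_nonneg_left (sqrt_ge_quadratic ha) h0.le
  have e2 := mul_le_mul_of_nonneg_left (sqrt_ge_quadratic hb) hq.le
  have e3 : p * ((1 + p' / p) / 2 - (p' / p - 1) ^ 2 / 2)
      + (1 - p) * ((1 + (1 - p') / (1 - p)) / 2 - ((1 - p') / (1 - p) - 1) ^ 2 / 2)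
      = 1 - (p' - p) ^ 2 / 2 * (1 / p + 1 / (1 - p)) := by
    field_simp
    ring
  linarith

namespace Strategy

variable {Ω : Type*} [MeasurableSpace Ω] {ι : Type} [MeasurableSpace ι] {n T : ℕ}
  {K : Set (Fin n → ℝ)} [Fintype ι] [MeasurableSingletonClass ι] [Nonempty ι]
  {v : ι → Fin n → ℝ}

/-- Against i.i.d. losses in `[-1, 1]^n`, some realization achieves the expected regret. -/
lemma exists_loss_of_le_integral_regret (S : Strategy Ω ι K) (hK : ∀ x ∈ K, ∀ i, |x i| ≤ 1)
    (hne : K.Nonempty) (hv : ∀ u i, |v u i| ≤ 1) {ν : Measure (Fin n → ℝ)}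
    [IsProbabilityMeasure ν] (hsupp : ∀ᵐ h ∂ν, ∀ i, |h i| ≤ 1) {B : ℝ}
    (hB : B ≤ ∫ ℓ : Fin T → Fin n → ℝ, S.regret v ℓ ∂(Measure.pi fun _ => ν)) :
    ∃ ℓ : Fin T → Fin n → ℝ, (∀ t i, |ℓ t i| ≤ 1) ∧ B ≤ S.regret v ℓ := by
  have hν : ∀ i, Integrable (fun h : Fin n → ℝ => h i) ν := fun i =>
    Integrable.of_bound (measurable_pi_apply i).aestronglyMeasurable 1
      (hsupp.mono fun h hh => hh i)
  obtain ⟨-, -, h3⟩ := S.integrable_regret (T := T) hK hne hv hν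
  have hae : ∀ᵐ ℓ : Fin T → Fin n → ℝ ∂(Measure.pi fun _ => ν), ∀ t i, |ℓ t i| ≤ 1 :=
    ae_all_iff.2 fun t =>
      (measurePreserving_eval (fun _ : Fin T => ν) t).quasiMeasurePreserving.ae hsupp
  obtain ⟨ℓ, hℓ, hle⟩ := exists_notMem_null_integral_le h3 hae
  exact ⟨ℓ, by simpa using hℓ, hB.trans hle⟩

/-- The needle in a haystack: random signs with biases `p i`, where the bias of one coordinate
`j ∈ J` may be shifted from `b` to `b + ε / 2`. -/
theorem exists_loss_of_needle (S : Strategy Ω ι K) (hK : ∀ x ∈ K, ∀ i, |x i| ≤ 1)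
    {coord : ι → Fin n} {sgn : ι → ℝ} (hv : IsSignedBasis v coord sgn)
    {J : Finset (Fin n)} (hJ : 2 ≤ J.card) {p : Fin n → ℝ} (hp0 : ∀ i, 0 ≤ p i)
    (hp1 : ∀ i, p i ≤ 1) {b ε c : ℝ} {h : NNReal} (hpJ : ∀ j ∈ J, p j = b) (hb0 : 0 < b)
    (hb1 : b < 1) (hε : 0 ≤ ε) (hbε : b + ε / 2 ≤ 1)
    (hh : (ε / 2) ^ 2 / 2 * (1 / b + 1 / (1 - b)) ≤ h)
    (hc : 2 / 3 * (h / n) * T * ε ≤ c) {f : (t : ℕ) → Ω × (Fin t → Signal ι) → Fin n → ℝ}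
    (hf : ∀ t j, Measurable fun x => f t x j) (hf0 : ∀ t x j, 0 ≤ f t x j)
    (hf1 : ∀ t x, ∑ j ∈ J, f t x j ≤ 1) {y₀ : Fin n → ℝ} (hy₀ : y₀ ∈ K)
    {y : Fin n → Fin n → ℝ} (hy : ∀ j ∈ J, y j ∈ K)
    (hbase : ∀ t x, (if S.explore t x.1 x.2 = true then c else 0)
      ≤ (fun i => 1 - 2 * p i) ⬝ᵥ S.meanPlayed v t x - (fun i => 1 - 2 * p i) ⬝ᵥ y₀)
    (hneedle : ∀ j ∈ J, ∀ t x, (if S.explore t x.1 x.2 = true then c else 0) + ε * (1 - f t x j)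
      ≤ ((fun i => 1 - 2 * p i) ⬝ᵥ S.meanPlayed v t x - ε * S.meanPlayed v t x j)
        - ((fun i => 1 - 2 * p i) ⬝ᵥ y j - ε * y j j)) :
    ∃ ℓ : Fin T → Fin n → ℝ, (∀ t i, |ℓ t i| ≤ 1) ∧ ε * T / 12 ≤ S.regret v ℓ := by
  have hprob : ∀ i, IsProbabilityMeasure (signLaw (p i)) := fun i =>
    isProbabilityMeasure_signLaw (hp0 i) (hp1 i)
  have hq0 : ∀ j i, 0 ≤ Function.update p j (b + ε / 2) i := fun j i => by
    by_cases hi : i = j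
    · subst hi; simp; positivity
    · simpa [hi] using hp0 i
  have hq1 : ∀ j i, Function.update p j (b + ε / 2) i ≤ 1 := fun j i => by
    by_cases hi : i = j
    · subst hi; simpa using hbε
    · simpa [hi] using hp1 i
  have hprob' : ∀ j i, IsProbabilityMeasure (signLaw (Function.update p j (b + ε / 2) i)) :=
    fun j i => isProbabilityMeasure_signLaw (hq0 j i) (hq1 j i)
  have hint : ∀ q : Fin n → ℝ, (∀ i, IsProbabilityMeasure (signLaw (q i))) → ∀ i,
      Integrable (fun h : Fin n → ℝ => h i) (Measure.pi fun i => signLaw (q i)) := fun q hq i =>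
    integrable_eval_pi (fun i => signLaw (q i)) (Integrable.of_bound
      measurable_id.aestronglyMeasurable 1 (ae_abs_le_one_signLaw _))
  have hmean : ∀ q : Fin n → ℝ, (∀ i, 0 ≤ q i) → (∀ i, q i ≤ 1) →
      (∀ i, IsProbabilityMeasure (signLaw (q i))) → ∀ i,
      ∫ h : Fin n → ℝ, h i ∂(Measure.pi fun i => signLaw (q i)) = 1 - 2 * q i :=
    fun q h0 h1 hq i => by
      rw [integral_eval_pi (fun i => signLaw (q i)) i (fun y => y) measurable_id,
        integral_signLaw (h0 i) (h1 i)]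
  have hf1' : ∀ j ∈ J, ∀ t x, f t x j ≤ 1 := fun j hj t x =>
    (Finset.single_le_sum (fun i _ => hf0 t x i) hj).trans (hf1 t x)
  have hfint : ∀ (P : (t : ℕ) → Measure (Ω × (Fin t → Signal ι))),
      (∀ t, IsProbabilityMeasure (P t)) → ∀ j ∈ J, ∀ t, Integrable (fun x => f t x j) (P t) :=
    fun P _ j hj t => Integrable.of_bound (hf t j).aestronglyMeasurable 1
      (Filter.Eventually.of_forall fun x => by
        rw [Real.norm_of_nonneg (hf0 t x j)]; exact hf1' j hj t x)
  -- `F j` is the weight put on `j` under the unshifted law, where the candidates share a total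
  -- weight of at most one per round; `A j` is the weight missing from `j` when `j` is the needle.
  have key := needle_of_sums hJ (T := T) (ε := ε) (c := c) (h := h / n)
    (X₀ := S.exploreCount v (Measure.pi fun i => signLaw (p i)) T)
    (R₀ := ∫ ℓ : Fin T → Fin n → ℝ, S.regret v ℓ
      ∂(Measure.pi fun _ => Measure.pi fun i => signLaw (p i)))
    (X := fun j => S.exploreCount v
      (Measure.pi fun i => signLaw (Function.update p j (b + ε / 2) i)) T)
    (R := fun j => ∫ ℓ : Fin T → Fin n → ℝ, S.regret v ℓ
      ∂(Measure.pi fun _ => Measure.pi fun i => signLaw (Function.update p j (b + ε / 2) i)))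
    (A := fun j => ∑ t ∈ Finset.range T, ∫ x, (1 - f t x j) ∂S.obsLaw v
      (Measure.pi fun i => signLaw (Function.update p j (b + ε / 2) i)) t)
    (F := fun j => ∑ t ∈ Finset.range T, ∫ x, f t x j ∂S.obsLaw v
      (Measure.pi fun i => signLaw (p i)) t)
    hε (Nat.cast_nonneg T) (S.exploreCount_nonneg _ _ _) (fun j => S.exploreCount_nonneg _ _ _)
    hc ?_ ?_ ?_ ?_
  · obtain hB | ⟨j, -, hB⟩ := key
    · exact S.exists_loss_of_le_integral_regret hK ⟨y₀, hy₀⟩ hv.abs_le_one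
        (ae_pi_of_ae _ fun i => ae_abs_le_one_signLaw _) hB
    · exact S.exists_loss_of_le_integral_regret hK ⟨y₀, hy₀⟩ hv.abs_le_one
        (ae_pi_of_ae _ fun i => ae_abs_le_one_signLaw _) hB
  · rw [Finset.sum_comm]
    refine (Finset.sum_le_card_nsmul _ _ 1 fun t _ => ?_).trans (by simp)
    rw [← integral_finsetSum _ fun j hj => hfint _ (fun _ => inferInstance) j hj t]
    refine (integral_mono (integrable_finsetSum _ fun j hj =>
      hfint _ (fun _ => inferInstance) j hj t) (integrable_const 1) (hf1 t)).trans (by simp)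
  · intro j hj
    have H := isLikelihoodRatio_coordLikelihood hv (κ := fun i => signLaw (p i))
      (κ' := fun i => signLaw (Function.update p j (b + ε / 2) i)) (j := j)
      (measurable_signDensity b (b + ε / 2))
      (fun i hi => by simp [hi])
      (by simp only [Function.update_self, hpJ j hj]; exact signLaw_eq_withDensity hb0 hb1)
      (h := h) (by
        simp only [hpJ j hj]
        exact one_le_affinity_signLaw hb0 hb1 (by positivity) hbε (by simpa using hh))
    have := S.sum_test_ge (T := T) H (f := fun t x => f t x j) (fun t => hf t j)
      (fun t x => hf0 t x j) (fun t x => hf1' j hj t x)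
    rwa [NNReal.coe_div, NNReal.coe_natCast] at this
  · have := S.exploreCount_add_le_integral_regret (T := T) hK hv.abs_le_one (hint p hprob)
      (hmean p hp0 hp1 hprob) hy₀ (c := c) (g := fun _ _ => 0)
      (fun t => integrable_zero _ _ _) (fun t x => by simpa using hbase t x)
    simpa using this
  · intro j hj
    -- A shift of the probability of `-1` by `ε / 2` lowers the mean of the sign by `ε`.
    have hupd : ∀ z : Fin n → ℝ, (fun i => 1 - 2 * Function.update p j (b + ε / 2) i) ⬝ᵥ z
        = (fun i => 1 - 2 * p i) ⬝ᵥ z - ε * z j := by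
      intro z
      have : (fun i => 1 - 2 * Function.update p j (b + ε / 2) i)
          = (fun i => 1 - 2 * p i) - Pi.single j ε := by
        funext i
        by_cases hi : i = j
        · subst hi; simp [hpJ i hj]; ring
        · simp [hi]
      rw [this, sub_dotProduct, single_dotProduct]
    have := S.exploreCount_add_le_integral_regret (T := T) hK hv.abs_le_one
      (hint _ (hprob' j)) (hmean _ (hq0 j) (hq1 j) (hprob' j)) (hy j hj) (c := c)
      (g := fun t x => ε * (1 - f t x j))
      (fun t => ((integrable_const 1).sub (hfint _ (fun _ => inferInstance) j hj t)).const_mul _)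
      (fun t x => by rw [hupd, hupd]; exact hneedle j hj t x)
    simp only [integral_const_mul, ← Finset.mul_sum] at this
    exact this

end Strategy
-- The multi-armed bandit and the `ℓ_1` ball
-- The value `δ = (n/T)^(1/3)` solves the balance `n/δ² = δT`; `n ≤ T` gives `δ ≤ 1`.
lemma explorationScale {n T : ℕ} (hn : 0 < n) (hT : n ≤ T) :
    ∃ δ : ℝ, 0 ≤ δ ∧ δ ≤ 1 ∧ δ ^ 3 * T = n ∧
      δ * T = (n : ℝ) ^ (1 / 3 : ℝ) * (T : ℝ) ^ (2 / 3 : ℝ) := by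
  have hn' : (0 : ℝ) < n := by exact_mod_cast hn
  have hT' : (n : ℝ) ≤ T := by exact_mod_cast hT
  have hT0 : (0 : ℝ) < T := hn'.trans_le hT'
  refine ⟨(n / T : ℝ) ^ (1 / 3 : ℝ), by positivity,
    Real.rpow_le_one (by positivity) ((div_le_one hT0).2 hT') (by norm_num), ?_, ?_⟩
  · rw [← Real.rpow_natCast, ← Real.rpow_mul (by positivity)]
    norm_num
    field_simp
  · rw [Real.div_rpow hn'.le hT0.le, div_mul_eq_mul_div, mul_div_assoc]
    congr 1
    rw [div_eq_iff (by positivity), ← Real.rpow_add hT0]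
    norm_num

lemma meanPlayed_of_explore {Ω : Type*} [MeasurableSpace Ω] {ι : Type} [MeasurableSpace ι]
    [Fintype ι] {n : ℕ} {K : Set (Fin n → ℝ)} (S : Strategy Ω ι K) (v : ι → Fin n → ℝ) {t : ℕ}
    {x : Ω × (Fin t → Signal ι)} (h : S.explore t x.1 x.2 = true) :
    S.meanPlayed v t x = fun i => Finset.univ.expect fun u => v u i := if_pos h

lemma meanPlayed_of_not_explore {Ω : Type*} [MeasurableSpace Ω] {ι : Type} [MeasurableSpace ι]
    [Fintype ι] {n : ℕ} {K : Set (Fin n → ℝ)} (S : Strategy Ω ι K) (v : ι → Fin n → ℝ) {t : ℕ}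
    {x : Ω × (Fin t → Signal ι)} (h : ¬ S.explore t x.1 x.2 = true) :
    S.meanPlayed v t x = S.action t x.1 x.2 := if_neg h

lemma abs_le_one_of_mem_arms {n : ℕ} : ∀ x ∈ arms n, ∀ i, |x i| ≤ 1 := by
  rintro _ ⟨k, rfl⟩ i
  exact (isSignedBasis_basisVec n).abs_le_one k i

/-- Half of the arms, rounded up, give fair signs and are the candidates; the others always lose
`1`. Uniform exploration then costs `⌊n/2⌋/n ≥ 1/3` per round, with equality at `n = 3`, and from `n
= 3` on there are at least two candidates. -/
theorem exists_loss_arms {n T : ℕ} (hn : 3 ≤ n) (hT : n ≤ T) {Ω : Type*} [MeasurableSpace Ω]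
    (S : Strategy Ω (Fin n) (arms n)) :
    ∃ ℓ : Fin T → Fin n → ℝ, (∀ t, ℓ t ∈ polarBody (arms n)) ∧
      1 / 20 * (n : ℝ) ^ (1 / 3 : ℝ) * (T : ℝ) ^ (2 / 3 : ℝ) ≤ S.regret basisVec ℓ := by
  have : Nonempty (Fin n) := ⟨⟨0, by omega⟩⟩
  have hn0 : (0 : ℝ) < n := by exact_mod_cast (by omega : 0 < n)
  obtain ⟨δ, hδ0, hδ1, hδ3, hδT⟩ := explorationScale (by omega : 0 < n) hT
  set J : Finset (Fin n) := Finset.univ.filter fun i => (i : ℕ) < n - n / 2 with hJ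
  have hJcard : J.card = n - n / 2 := by
    rw [hJ, Fin.card_filter_val_lt]
    omega
  set p : Fin n → ℝ := fun i => if i ∈ J then 1 / 2 else 0 with hp
  have hθ : ∀ i, (0 : ℝ) ≤ 1 - 2 * p i := fun i => by
    simp only [hp]; split_ifs <;> norm_num
  have hθJ : ∀ i ∈ J, (1 : ℝ) - 2 * p i = 0 := fun i hi => by
    simp only [hp, hi, if_true]; norm_num
  have hsum : ∑ i, ((1 : ℝ) - 2 * p i) = (n / 2 : ℕ) := by
    have : ∀ i, (1 : ℝ) - 2 * p i = 1 - if i ∈ J then 1 else 0 := fun i => by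
      simp only [hp]; split_ifs <;> norm_num
    simp only [this, Finset.sum_sub_distrib, Finset.sum_ite_mem, Finset.univ_inter,
      Finset.sum_const, Finset.card_univ, Fintype.card_fin, hJcard, nsmul_eq_mul, mul_one]
    rw [Nat.cast_sub (by omega)]
    ring
  have hthird : (1 / 3 : ℝ) ≤ (n / 2 : ℕ) * (1 / n) := by
    rw [mul_one_div, div_le_div_iff₀ (by norm_num) hn0]
    exact_mod_cast (by omega : 1 * n ≤ n / 2 * 3)
  have hcost : ∀ t x, (if S.explore t x.1 x.2 = true then (1 / 3 : ℝ) else 0)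
      ≤ (fun i => 1 - 2 * p i) ⬝ᵥ S.meanPlayed basisVec t x := by
    intro t x
    by_cases he : S.explore t x.1 x.2 = true
    · rw [if_pos he, meanPlayed_of_explore S _ he]
      simp only [expect_basisVec, dotProduct, ← Finset.sum_mul, hsum]
      exact hthird
    · rw [if_neg he, meanPlayed_of_not_explore S _ he]
      obtain ⟨k, hk⟩ := S.action_mem t x.1 x.2
      rw [← hk, basisVec, dotProduct_single, mul_one]
      exact hθ k
  have hmp0 : ∀ t x i, 0 ≤ S.meanPlayed basisVec t x i := by
    intro t x i
    by_cases he : S.explore t x.1 x.2 = true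
    · rw [meanPlayed_of_explore S _ he]
      simp only [expect_basisVec]
      positivity
    · rw [meanPlayed_of_not_explore S _ he]
      obtain ⟨k, hk⟩ := S.action_mem t x.1 x.2
      rw [← hk, basisVec, Pi.single_apply]
      split_ifs <;> norm_num
  have hmp1 : ∀ t x, ∑ i, S.meanPlayed basisVec t x i = 1 := by
    intro t x
    by_cases he : S.explore t x.1 x.2 = true
    · rw [meanPlayed_of_explore S _ he]
      simp only [expect_basisVec]
      simp [hn0.ne']
    · rw [meanPlayed_of_not_explore S _ he]
      obtain ⟨k, hk⟩ := S.action_mem t x.1 x.2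
      rw [← hk]
      simp [basisVec]
  have hmem0 : (⟨0, by omega⟩ : Fin n) ∈ J := by simp [hJ]; omega
  -- At `b = 1/2` the divergence bound is `ε²/2`. With `ε = 2δ/3` the budget condition reads `8/81 ≤
  -- 1/3`, and the resulting regret is `εT/12 = δT/18`.
  obtain ⟨ℓ, hℓ, hle⟩ := S.exists_loss_of_needle (T := T) (J := J) (p := p) (b := 1 / 2)
    (ε := 2 / 3 * δ) (c := 1 / 3) (h := ((2 / 3 * δ) ^ 2 / 2).toNNReal)
    abs_le_one_of_mem_arms (isSignedBasis_basisVec n) (by omega)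
    (fun i => by simp only [hp]; split_ifs <;> norm_num)
    (fun i => by simp only [hp]; split_ifs <;> norm_num)
    (fun j hj => by simp [hp, hj]) (by norm_num) (by norm_num) (by positivity) (by linarith)
    (by rw [Real.coe_toNNReal _ (by positivity)]; apply le_of_eq; ring)
    (by
      rw [Real.coe_toNNReal _ (by positivity)]
      have : 2 / 3 * ((2 / 3 * δ) ^ 2 / 2 / n) * T * (2 / 3 * δ) = 8 / 81 * (δ ^ 3 * T / n) := by
        ring
      rw [this, hδ3, div_self hn0.ne']
      norm_num)
    (f := S.meanPlayed basisVec)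
    (fun t j => (measurable_pi_apply j).comp (S.measurable_meanPlayed basisVec t)) hmp0
    (fun t x => (Finset.sum_le_univ_sum_of_nonneg (hmp0 t x)).trans (hmp1 t x).le)
    (y₀ := basisVec ⟨0, by omega⟩) ⟨_, rfl⟩ (y := basisVec) (fun j _ => ⟨j, rfl⟩)
    (fun t x => by
      rw [basisVec, dotProduct_single, hθJ _ hmem0, zero_mul, sub_zero]
      exact hcost t x)
    (fun j hj t x => by
      rw [basisVec, dotProduct_single, hθJ _ hj, Pi.single_eq_same]
      linarith [hcost t x])
  refine ⟨ℓ, fun t => ?_, le_trans ?_ hle⟩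
  · rintro _ ⟨k, rfl⟩
    rw [basisVec, dotProduct_single, mul_one]
    exact hℓ t k
  · have h0 : 0 ≤ δ * T := by positivity
    rw [mul_assoc, ← hδT]
    linarith

lemma ellNorm_one {n : ℕ} (x : Fin n → ℝ) : ellNorm 1 x = ∑ i, |x i| := by
  simp [ellNorm, PiLp.norm_eq_of_L1]

lemma abs_apply_le_ellNorm {n : ℕ} {p : ℝ≥0∞} (hp : 1 ≤ p) (x : Fin n → ℝ) (i : Fin n) :
    |x i| ≤ ellNorm p x := by
  have : Fact (1 ≤ p) := ⟨hp⟩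
  exact PiLp.norm_apply_le (WithLp.toLp p x) i

lemma abs_le_one_of_mem_ellBall {n : ℕ} {p : ℝ≥0∞} (hp : 1 ≤ p) :
    ∀ x ∈ ellBall n p, ∀ i, |x i| ≤ 1 :=
  fun x hx i => (abs_apply_le_ellNorm hp x i).trans hx

/-- In the base law all coordinates have mean `-1/3`, so every basis vector is optimal, while the
exploratory mean is the origin and costs `1/3`. The `ℓ_1` constraint bounds the total weight `∑ |x
i|` put on the candidates, which are all the coordinates. -/
theorem exists_loss_ellBall_one {n T : ℕ} (hn : 2 ≤ n) (hT : n ≤ T) {Ω : Type*}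
    [MeasurableSpace Ω] (S : Strategy Ω (Fin n × Bool) (ellBall n 1)) :
    ∃ ℓ : Fin T → Fin n → ℝ, (∀ t, ℓ t ∈ polarBody (ellBall n 1)) ∧
      1 / 20 * (n : ℝ) ^ (1 / 3 : ℝ) * (T : ℝ) ^ (2 / 3 : ℝ) ≤ S.regret signedBasisVec ℓ := by
  have : Nonempty (Fin n) := ⟨⟨0, by omega⟩⟩
  have hn0 : (0 : ℝ) < n := by exact_mod_cast (by omega : 0 < n)
  obtain ⟨δ, hδ0, hδ1, hδ3, hδT⟩ := explorationScale (by omega : 0 < n) hT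
  have hball : ∀ x ∈ ellBall n 1, ∑ i, |x i| ≤ 1 := fun x hx => by
    rw [← ellNorm_one]; exact hx
  have hbasis : ∀ j : Fin n, basisVec j ∈ ellBall n 1 := fun j => by
    change ellNorm 1 _ ≤ 1
    rw [ellNorm_one, Finset.sum_eq_single j]
    · simp [basisVec]
    · intro i _ hi; simp [basisVec, hi]
    · simp
  have hmp : ∀ t x, ∑ i, |S.meanPlayed signedBasisVec t x i| ≤ 1 := by
    intro t x
    by_cases he : S.explore t x.1 x.2 = true
    · rw [meanPlayed_of_explore S _ he]
      simp [expect_signedBasisVec]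
    · rw [meanPlayed_of_not_explore S _ he]
      exact hball _ (S.action_mem _ _ _)
  have hdot : ∀ z : Fin n → ℝ, (fun _ : Fin n => (1 : ℝ) - 2 * (2 / 3)) ⬝ᵥ z
      = -(1 / 3) * ∑ i, z i := fun z => by
    simp only [dotProduct, Finset.mul_sum]
    exact Finset.sum_congr rfl fun i _ => by ring
  have hdotb : ∀ j, (fun _ : Fin n => (1 : ℝ) - 2 * (2 / 3)) ⬝ᵥ basisVec j = -(1 / 3) := fun j => by
    rw [basisVec, dotProduct_single]; norm_num
  have hcost : ∀ t x, (if S.explore t x.1 x.2 = true then (1 / 3 : ℝ) else 0)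
      ≤ (fun _ => (1 : ℝ) - 2 * (2 / 3)) ⬝ᵥ S.meanPlayed signedBasisVec t x + 1 / 3 := by
    intro t x
    rw [hdot]
    split_ifs with he
    · rw [meanPlayed_of_explore S _ he]
      simp [expect_signedBasisVec]
    · have := (Finset.sum_le_sum fun i _ => le_abs_self _).trans (hmp t x)
      linarith
  -- At `b = 2/3` the divergence bound is `(ε²/8)(3/2 + 3) = (9/16) ε²`. With `ε = 2δ/3` the budget
  -- condition reads `1/9 ≤ 1/3`, and `δ ≤ 1` keeps the shifted probability at most `1`.
  obtain ⟨ℓ, hℓ, hle⟩ := S.exists_loss_of_needle (T := T) (J := Finset.univ) (p := fun _ => 2 / 3)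
    (b := 2 / 3) (ε := 2 / 3 * δ) (c := 1 / 3)
    (h := (9 / 16 * (2 / 3 * δ) ^ 2).toNNReal)
    (abs_le_one_of_mem_ellBall le_rfl) (isSignedBasis_signedBasisVec n) (by simpa using hn)
    (fun i => by norm_num) (fun i => by norm_num)
    (fun j hj => rfl) (by norm_num) (by norm_num) (by positivity) (by linarith)
    (by rw [Real.coe_toNNReal _ (by positivity)]; apply le_of_eq; ring)
    (by
      rw [Real.coe_toNNReal _ (by positivity)]
      have : 2 / 3 * (9 / 16 * (2 / 3 * δ) ^ 2 / n) * T * (2 / 3 * δ)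
          = 1 / 9 * (δ ^ 3 * T / n) := by
        ring
      rw [this, hδ3, div_self hn0.ne']
      norm_num)
    (f := fun t x i => |S.meanPlayed signedBasisVec t x i|)
    (fun t j => ((measurable_pi_apply j).comp (S.measurable_meanPlayed signedBasisVec t)).abs)
    (fun t x i => abs_nonneg _) hmp (y₀ := basisVec ⟨0, by omega⟩) (hbasis _) (y := basisVec)
    (fun j _ => hbasis j)
    (fun t x => by
      rw [hdotb, sub_neg_eq_add]
      exact hcost t x)
    (fun j hj t x => by
      have h1 := mul_le_mul_of_nonneg_left (le_abs_self (S.meanPlayed signedBasisVec t x j))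
        (by positivity : 0 ≤ 2 / 3 * δ)
      rw [hdotb, basisVec, Pi.single_eq_same]
      linarith [hcost t x])
  refine ⟨ℓ, fun t x hx => ?_, le_trans ?_ hle⟩
  · refine (Finset.abs_sum_le_sum_abs _ _).trans (le_trans (Finset.sum_le_sum fun i _ => ?_)
      (hball x hx))
    rw [abs_mul]
    exact mul_le_of_le_one_left (abs_nonneg _) (hℓ t i)
  · have h0 : 0 ≤ δ * T := by positivity
    rw [mul_assoc, ← hδT]
    linarith

/-! ### Duality on the `ℓ_p` ball -/

lemma ellNorm_rpow {n : ℕ} {q : ℝ≥0∞} (hq : 0 < q.toReal) (x : Fin n → ℝ) :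
    ellNorm q x ^ q.toReal = ∑ i, |x i| ^ q.toReal := by
  rw [ellNorm, PiLp.norm_eq_sum hq, ← Real.rpow_mul (by positivity), one_div,
    inv_mul_cancel₀ hq.ne', Real.rpow_one]
  simp [Real.norm_eq_abs]

lemma mem_ellBall_iff {n : ℕ} {p : ℝ≥0∞} (hp : 0 < p.toReal) (x : Fin n → ℝ) :
    x ∈ ellBall n p ↔ ∑ i, |x i| ^ p.toReal ≤ 1 := by
  have h0 : 0 ≤ ellNorm p x := by
    rw [ellNorm, PiLp.norm_eq_sum hp]; positivity
  have h1 := Real.rpow_le_rpow_iff h0 zero_le_one hp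
  rw [Real.one_rpow] at h1
  rw [← ellNorm_rpow hp]
  exact h1.symm

lemma mem_ellBall_top {n : ℕ} {x : Fin n → ℝ} (hx : ∀ i, |x i| ≤ 1) : x ∈ ellBall n ∞ := by
  change ‖WithLp.toLp ∞ x‖ ≤ 1
  rw [PiLp.norm_eq_ciSup]
  exact Real.iSup_le hx zero_le_one

/-- The exponent conjugate to some `p > 2`. -/
lemma toReal_conj {p q : ℝ≥0∞} (hp : 2 < p) (hpq : p⁻¹ + q⁻¹ = 1) :
    1 ≤ q.toReal ∧ q.toReal < 2 ∧
      ((p = ∞ ∧ q.toReal = 1) ∨ (0 < p.toReal ∧ p.toReal.HolderConjugate q.toReal)) := by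
  rcases eq_or_ne p ∞ with rfl | hpt
  · have hq : q = 1 := by simpa using hpq
    simp [hq]
  · have hp0 : p ≠ 0 := (two_pos.trans hp).ne'
    have hp2 : 2 < p.toReal := by
      have := (ENNReal.toReal_lt_toReal (by simp) hpt).2 hp
      simpa using this
    have hq0 : q ≠ 0 := by
      rintro rfl
      simp at hpq
    have hqt : q ≠ ∞ := by
      rintro rfl
      simp only [ENNReal.inv_top, add_zero, ENNReal.inv_eq_one] at hpq
      rw [hpq] at hp
      exact absurd hp (by norm_num)
    have hqpos : 0 < q.toReal := ENNReal.toReal_pos hq0 hqt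
    have hr : p.toReal⁻¹ + q.toReal⁻¹ = 1 := by
      have := congrArg ENNReal.toReal hpq
      rwa [ENNReal.toReal_add (by simpa using hp0) (by simpa using hq0), ENNReal.toReal_inv,
        ENNReal.toReal_inv, ENNReal.toReal_one] at this
    have hpinv : p.toReal⁻¹ < 2⁻¹ := inv_strictAnti₀ two_pos hp2
    have hpinv0 : 0 < p.toReal⁻¹ := by positivity
    refine ⟨?_, ?_, Or.inr ⟨by linarith, Real.holderConjugate_iff.2 ⟨by linarith, hr⟩⟩⟩
    · rw [← inv_le_one_iff₀.trans (or_iff_right hqpos.not_ge)]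
      linarith
    · rw [← inv_lt_inv₀ two_pos hqpos]
      linarith

/-- Young's inequality, summed over the coordinates of a point of the `ℓ_p` ball. -/
lemma sum_mul_abs_le {n : ℕ} {p q : ℝ≥0∞} (hp : 2 < p) (hpq : p⁻¹ + q⁻¹ = 1) {x : Fin n → ℝ}
    (hx : x ∈ ellBall n p) {w : Fin n → ℝ} (hw : ∀ i, 0 ≤ w i) :
    ∑ i, w i * |x i| ≤ (∑ i, w i ^ q.toReal) / q.toReal + (1 - 1 / q.toReal) := by
  obtain ⟨-, -, ⟨rfl, hq⟩ | ⟨hp0, hc⟩⟩ := toReal_conj hp hpq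
  -- For `p = ∞` the exponent `q` is `1`, the additive constant vanishes, and `|x i| ≤ 1` replaces
  -- Young's inequality.
  · simp only [hq, Real.rpow_one, div_one, sub_self, add_zero]
    exact Finset.sum_le_sum fun i _ =>
      mul_le_of_le_one_right (hw i) (abs_le_one_of_mem_ellBall le_top x hx i)
  · have hpinv : 1 - 1 / q.toReal = 1 / p.toReal := by
      have := hc.inv_add_inv_eq_one
      rw [one_div, one_div]; linarith
    calc ∑ i, w i * |x i| ≤ ∑ i, (w i ^ q.toReal / q.toReal + |x i| ^ p.toReal / p.toReal) :=
          Finset.sum_le_sum fun i _ =>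
            Real.young_inequality_of_nonneg (hw i) (abs_nonneg _) hc.symm
      _ = (∑ i, w i ^ q.toReal) / q.toReal + (∑ i, |x i| ^ p.toReal) / p.toReal := by
          rw [Finset.sum_add_distrib, Finset.sum_div, Finset.sum_div]
      _ ≤ _ := by
          rw [hpinv]
          gcongr
          exact (mem_ellBall_iff hp0 x).1 hx

/-- The point of the `ℓ_p` ball at which the functional with coordinates `w i * s i` attains its
norm. -/
lemma dualPoint_mem_ellBall {n : ℕ} {p q : ℝ≥0∞} (hp : 2 < p) (hpq : p⁻¹ + q⁻¹ = 1)
    {w s : Fin n → ℝ} (hw : ∀ i, 0 ≤ w i) (hw1 : ∑ i, w i ^ q.toReal = 1) (hs : ∀ i, |s i| = 1) :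
    (fun i => s i * w i ^ (q.toReal - 1)) ∈ ellBall n p := by
  obtain ⟨-, -, ⟨rfl, hq⟩ | ⟨hp0, hc⟩⟩ := toReal_conj hp hpq
  · refine mem_ellBall_top fun i => ?_
    simp [hq, hs]
  · rw [mem_ellBall_iff hp0]
    refine le_of_eq (Eq.trans (Finset.sum_congr rfl fun i _ => ?_) hw1)
    rw [abs_mul, hs, one_mul, abs_of_nonneg (Real.rpow_nonneg (hw i) _), ← Real.rpow_mul (hw i)]
    congr 1
    exact hc.symm.sub_one_mul_conj

lemma mul_dualPoint {q w s : ℝ} (hq : 1 ≤ q) (hw : 0 ≤ w) (hs : |s| = 1) :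
    (w * s) * (s * w ^ (q - 1)) = w ^ q := by
  have h1 : s * s = 1 := by rw [← abs_mul_abs_self, hs, one_mul]
  calc (w * s) * (s * w ^ (q - 1)) = (s * s) * (w ^ (q - 1) * w) := by ring
    _ = w ^ q := by
      rcases hw.eq_or_lt with rfl | hw
      · rw [mul_zero, mul_zero, Real.zero_rpow (by linarith)]
      · rw [h1, one_mul, ← Real.rpow_add_one hw.ne', sub_add_cancel]

/-- Regret on the `ℓ_p` ball is controlled by the weight of the coordinates with a wrong sign. -/
lemma wrong_sign_le {n : ℕ} {p q : ℝ≥0∞} (hp : 2 < p) (hpq : p⁻¹ + q⁻¹ = 1)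
    {w s x : Fin n → ℝ} (hw : ∀ i, 0 ≤ w i) (hw1 : ∑ i, w i ^ q.toReal = 1)
    (hs : ∀ i, |s i| = 1) (hx : x ∈ ellBall n p) :
    (∑ i, if s i * x i ≤ 0 then w i ^ q.toReal else 0) / q.toReal
      ≤ 1 - ∑ i, w i * s i * x i := by
  have hq : 1 ≤ q.toReal := (toReal_conj hp hpq).1
  have hq0 : q.toReal ≠ 0 := by linarith
  have hw' : ∀ i, 0 ≤ if s i * x i ≤ 0 then 0 else w i := fun i => by
    split_ifs
    exacts [le_rfl, hw i]
  -- Deleting the weights of wrong-sign coordinates only increases the pairing. Young's inequality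
  -- for the remaining weights has the total `q`-mass reduced by exactly the wrong mass, divided by
  -- `q`.
  have h1 := sum_mul_abs_le hp hpq hx hw'
  have h2 : ∑ i, w i * s i * x i ≤ ∑ i, (if s i * x i ≤ 0 then 0 else w i) * |x i| := by
    refine Finset.sum_le_sum fun i _ => ?_
    split_ifs with h
    · rw [zero_mul, mul_assoc]
      exact mul_nonpos_of_nonneg_of_nonpos (hw i) h
    · rw [mul_assoc]
      refine mul_le_mul_of_nonneg_left ((le_abs_self _).trans ?_) (hw i)
      rw [abs_mul, hs, one_mul]
  have h3 : (∑ i, if s i * x i ≤ 0 then w i ^ q.toReal else 0)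
      + ∑ i, (if s i * x i ≤ 0 then 0 else w i) ^ q.toReal = 1 := by
    rw [← Finset.sum_add_distrib, ← hw1]
    refine Finset.sum_congr rfl fun i _ => ?_
    split_ifs
    · rw [Real.zero_rpow hq0, add_zero]
    · rw [zero_add]
  have h4 := congrArg (· / q.toReal) h3
  simp only [add_div] at h4
  linarith

/-! ### Gaussian shifts and moments -/

/-- The density of `gaussianReal m' v` with respect to `gaussianReal m v`. -/
noncomputable def gaussianRatio (m m' : ℝ) (v : NNReal) (y : ℝ) : ℝ≥0∞ :=
  ENNReal.ofReal (Real.exp ((2 * y * (m' - m) - (m' ^ 2 - m ^ 2)) / (2 * v)))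

lemma measurable_gaussianRatio (m m' : ℝ) (v : NNReal) : Measurable (gaussianRatio m m' v) := by
  unfold gaussianRatio
  fun_prop

lemma gaussianReal_eq_withDensity (m m' : ℝ) {v : NNReal} (hv : v ≠ 0) :
    gaussianReal m' v = (gaussianReal m v).withDensity (gaussianRatio m m' v) := by
  have hv' : (v : ℝ) ≠ 0 := by exact_mod_cast hv
  rw [gaussianReal_of_var_ne_zero m' hv, gaussianReal_of_var_ne_zero m hv,
    ← withDensity_mul _ (measurable_gaussianPDF m v) (measurable_gaussianRatio m m' v)]
  congr 1
  funext y
  simp only [Pi.mul_apply, gaussianPDF, gaussianRatio, gaussianPDFReal]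
  rw [← ENNReal.ofReal_mul (by positivity), mul_assoc _ (Real.exp _) (Real.exp _),
    ← Real.exp_add]
  congr 3
  field_simp
  ring

/-- By completing the square, the geometric mean of the two densities is the density centred at the
midpoint times `exp (-(m' - m)² / (8v))`. -/
lemma one_le_affinity_gaussian (m m' : ℝ) {v : NNReal} (hv : v ≠ 0) {h : NNReal}
    (hh : (m' - m) ^ 2 / (8 * v) ≤ h) :
    1 ≤ ∫⁻ y, gaussianRatio m m' v y ^ (1 / 2 : ℝ) ∂gaussianReal m v + h := by
  have hv' : (v : ℝ) ≠ 0 := by exact_mod_cast hv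
  have hm : Measurable fun y => gaussianRatio m m' v y ^ (1 / 2 : ℝ) :=
    (measurable_gaussianRatio m m' v).pow_const _
  rw [gaussianReal_of_var_ne_zero m hv,
    lintegral_withDensity_eq_lintegral_mul _ (measurable_gaussianPDF m v) hm]
  have hpt : ∀ y, (gaussianPDF m v * fun y => gaussianRatio m m' v y ^ (1 / 2 : ℝ)) y
      = ENNReal.ofReal (Real.exp (-((m' - m) ^ 2 / (8 * v)))) * gaussianPDF ((m + m') / 2) v y := by
    intro y
    simp only [Pi.mul_apply, gaussianPDF, gaussianRatio, gaussianPDFReal]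
    rw [ENNReal.ofReal_rpow_of_nonneg (Real.exp_pos _).le (by norm_num), ← Real.exp_mul,
      ← ENNReal.ofReal_mul (by positivity), ← ENNReal.ofReal_mul (by positivity), mul_assoc,
      ← Real.exp_add, mul_left_comm, ← Real.exp_add]
    congr 3
    field_simp
    ring
  simp_rw [hpt]
  rw [lintegral_const_mul _ (measurable_gaussianPDF _ _), lintegral_gaussianPDF_eq_one _ hv,
    mul_one, ← ENNReal.ofReal_coe_nnreal (p := h), ← ENNReal.ofReal_add (by positivity)
    (by positivity), ← ENNReal.ofReal_one]
  refine ENNReal.ofReal_le_ofReal ?_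
  linarith [Real.one_sub_le_exp_neg ((m' - m) ^ 2 / (8 * v : ℝ))]

lemma isGaussian_pi_gaussianReal {n : ℕ} (m : Fin n → ℝ) (v : Fin n → NNReal) :
    IsGaussian (Measure.pi fun i => gaussianReal (m i) (v i)) := by
  have hind : iIndepFun (β := fun _ => ℝ) (fun (i : Fin n) (h : Fin n → ℝ) => h i)
      (Measure.pi fun i => gaussianReal (m i) (v i)) :=
    iIndepFun_pi (𝓧 := fun _ => ℝ) (X := fun _ => id) fun i => aemeasurable_id
  have hX : ∀ i, HasGaussianLaw (fun h : Fin n → ℝ => h i)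
      (Measure.pi fun i => gaussianReal (m i) (v i)) := fun i => ⟨by
    have : Measure.map (fun h : Fin n → ℝ => h i) (Measure.pi fun i => gaussianReal (m i) (v i))
        = gaussianReal (m i) (v i) :=
      (measurePreserving_eval (fun i => gaussianReal (m i) (v i)) i).map_eq
    rw [this]
    infer_instance⟩
  have h := (iIndepFun.hasGaussianLaw hX hind).isGaussian_map
  simpa using h

lemma integrable_sq_gaussianReal (m : ℝ) (v : NNReal) :
    Integrable (fun y => y ^ 2) (gaussianReal m v) :=
  (memLp_id_gaussianReal' (μ := m) (v := v) 2 (by simp)).integrable_sq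

lemma integral_sq_gaussianReal (m : ℝ) (v : NNReal) :
    ∫ y, y ^ 2 ∂gaussianReal m v = m ^ 2 + v := by
  have h := variance_eq_sub (memLp_id_gaussianReal' (μ := m) (v := v) 2 (by simp))
  rw [variance_id_gaussianReal] at h
  simp only [id, Pi.pow_apply, integral_id_gaussianReal] at h
  linarith

/-- Splitting at `|y| = τ` reduces `q`-th moments to second moments, at the cost of a constant only.
-/
lemma abs_rpow_le {q τ : ℝ} (hq0 : 0 ≤ q) (hq : q ≤ 2) (hτ : 0 < τ) (y : ℝ) :
    |y| ^ q ≤ τ ^ q * (1 + y ^ 2 / τ ^ 2) := by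
  have h1 : |y| ^ q = τ ^ q * (|y| / τ) ^ q := by
    rw [← Real.mul_rpow hτ.le (by positivity), mul_div_cancel₀ _ hτ.ne']
  rw [h1]
  refine mul_le_mul_of_nonneg_left ?_ (by positivity)
  have h2 : y ^ 2 / τ ^ 2 = (|y| / τ) ^ 2 := by rw [div_pow, sq_abs]
  rw [h2]
  have h0 : 0 ≤ |y| / τ := by positivity
  rcases le_total (|y| / τ) 1 with h | h
  · linarith [Real.rpow_le_one h0 h hq0, sq_nonneg (|y| / τ)]
  · have := Real.rpow_le_rpow_of_exponent_le h hq
    rw [Real.rpow_two] at this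
    linarith

lemma integrable_abs_rpow_gaussianReal {q : ℝ} (hq0 : 0 ≤ q) (hq : q ≤ 2) (m : ℝ) (v : NNReal) :
    Integrable (fun y => |y| ^ q) (gaussianReal m v) := by
  have hi : Integrable (fun y => 1 ^ q * (1 + y ^ 2 / 1 ^ 2)) (gaussianReal m v) :=
    ((integrable_const 1).add ((integrable_sq_gaussianReal m v).div_const _)).const_mul _
  refine hi.mono' (by fun_prop) (Filter.Eventually.of_forall fun y => ?_)
  rw [Real.norm_of_nonneg (by positivity)]
  exact abs_rpow_le hq0 hq one_pos y

lemma integral_abs_rpow_gaussianReal_le {q τ : ℝ} (hq0 : 0 ≤ q) (hq : q ≤ 2) (hτ : 0 < τ)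
    {m : ℝ} (hm : |m| ≤ τ) {v : NNReal} (hv : (v : ℝ) ≤ τ ^ 2) :
    ∫ y, |y| ^ q ∂gaussianReal m v ≤ 3 * τ ^ q := by
  have hi : Integrable (fun y => τ ^ q * (1 + y ^ 2 / τ ^ 2)) (gaussianReal m v) :=
    ((integrable_const 1).add ((integrable_sq_gaussianReal m v).div_const _)).const_mul _
  refine (integral_mono (integrable_abs_rpow_gaussianReal hq0 hq m v) hi
    fun y => abs_rpow_le hq0 hq hτ y).trans ?_
  rw [integral_const_mul, integral_add (integrable_const _)
    ((integrable_sq_gaussianReal m v).div_const _), integral_div, integral_sq_gaussianReal,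
    mul_comm (3 : ℝ)]
  refine mul_le_mul_of_nonneg_left ?_ (by positivity)
  simp only [integral_const, probReal_univ, smul_eq_mul, mul_one]
  have : (m ^ 2 + v) / τ ^ 2 ≤ 2 := by
    rw [div_le_iff₀ (by positivity)]
    have := sq_le_sq' (abs_le.1 hm).1 (abs_le.1 hm).2
    linarith
  linarith

/-! ### Scale of the hidden signal and minimizers on the ball -/

/-- The value `ε = (n/T)^(1/(2+q))` solves the balance `n/ε² = ε^q T`. -/
lemma explorationScale_rpow {q : ℝ} (hq : 0 < q) {n T : ℕ} (hn : 0 < n) (hT : n ≤ T) :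
    ∃ ε : ℝ, 0 < ε ∧ ε ≤ 1 ∧ ε ^ q * ε ^ 2 * T = n ∧
      ε ^ q * T = (n : ℝ) ^ (q / (2 + q)) * (T : ℝ) ^ (2 / (2 + q)) := by
  have hn' : (0 : ℝ) < n := by exact_mod_cast hn
  have hT' : (n : ℝ) ≤ T := by exact_mod_cast hT
  have hT0 : (0 : ℝ) < T := hn'.trans_le hT'
  have hε : 0 < (n / T : ℝ) ^ (1 / (2 + q)) := by positivity
  refine ⟨(n / T : ℝ) ^ (1 / (2 + q)), hε,
    Real.rpow_le_one (by positivity) ((div_le_one hT0).2 hT') (by positivity), ?_, ?_⟩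
  · rw [← Real.rpow_two, ← Real.rpow_add hε, ← Real.rpow_mul (by positivity), add_comm q,
      one_div_mul_cancel (by positivity), Real.rpow_one]
    field_simp
  · rw [← Real.rpow_mul (by positivity), Real.div_rpow hn'.le hT0.le, div_mul_eq_mul_div,
      mul_div_assoc, one_div_mul_eq_div]
    congr 1
    rw [div_eq_iff (by positivity), ← Real.rpow_add hT0, ← add_div, div_self (by positivity),
      Real.rpow_one]

/-- The minimizer of a linear functional on the `ℓ_p` ball, and the suboptimality of points of which
some coordinates have the wrong sign. -/
lemma exists_minimizer_ellBall {n : ℕ} {p q : ℝ≥0∞} (hp : 2 < p) (hpq : p⁻¹ + q⁻¹ = 1)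
    {W : Fin n → ℝ} (hW : ∀ i, 0 ≤ W i) (hW0 : 0 < ∑ i, W i ^ q.toReal)
    (hW1 : ∑ i, W i ^ q.toReal ≤ 1) :
    ∃ N : ℝ, 0 < N ∧ N ^ q.toReal = ∑ i, W i ^ q.toReal ∧
      ∀ s : Fin n → ℝ, (∀ i, |s i| = 1) → ∃ y ∈ ellBall n p,
        (fun i => -(W i * s i)) ⬝ᵥ y = -N ∧ ∀ x ∈ ellBall n p,
          (∑ i, if s i * x i ≤ 0 then W i ^ q.toReal else 0) / q.toReal
            ≤ (fun i => -(W i * s i)) ⬝ᵥ x + N := by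
  have hq : 1 ≤ q.toReal := (toReal_conj hp hpq).1
  have hq0 : 0 < q.toReal := by linarith
  set M := ∑ i, W i ^ q.toReal with hM
  set N := M ^ (1 / q.toReal) with hN
  have hN0 : 0 < N := by positivity
  have hN1 : N ≤ 1 := Real.rpow_le_one hW0.le hW1 (by positivity)
  have hNq : N ^ q.toReal = M := by
    rw [hN, ← Real.rpow_mul hW0.le, one_div_mul_cancel hq0.ne', Real.rpow_one]
  -- Since `N ≤ 1 ≤ q`, the mass `M = N^q` is at most `N`. Hence `W i ^ q ≤ N * w i ^ q`, and the
  -- gap for the normalized weights gives the gap for `W`.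
  have hNle : N ^ q.toReal ≤ N := by
    have := Real.rpow_le_rpow_of_exponent_ge hN0 hN1 hq
    rwa [Real.rpow_one] at this
  set w : Fin n → ℝ := fun i => W i / N with hw
  have hw0 : ∀ i, 0 ≤ w i := fun i => div_nonneg (hW i) hN0.le
  have hwq : ∀ i, w i ^ q.toReal = W i ^ q.toReal / M := fun i => by
    rw [hw, Real.div_rpow (hW i) hN0.le, hNq]
  have hw1 : ∑ i, w i ^ q.toReal = 1 := by
    simp only [hwq, ← Finset.sum_div]
    exact div_self hW0.ne'
  refine ⟨N, hN0, hNq, fun s hs => ?_⟩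
  have hdot : ∀ x : Fin n → ℝ, (fun i => -(W i * s i)) ⬝ᵥ x = -N * ∑ i, w i * s i * x i := by
    intro x
    simp only [dotProduct, Finset.mul_sum]
    refine Finset.sum_congr rfl fun i _ => ?_
    have : W i = N * w i := by rw [hw]; field_simp
    rw [this]
    ring
  refine ⟨_, dualPoint_mem_ellBall hp hpq hw0 hw1 hs, ?_, fun x hx => ?_⟩
  · rw [hdot]
    simp only [mul_dualPoint hq (hw0 _) (hs _), hw1, mul_one]
  · have h1 := mul_le_mul_of_nonneg_left (wrong_sign_le hp hpq hw0 hw1 hs hx) hN0.le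
    rw [hdot]
    refine le_trans ?_ (h1.trans (by linarith))
    rw [mul_div_assoc', Finset.mul_sum]
    refine div_le_div_of_nonneg_right (Finset.sum_le_sum fun i _ => ?_) hq0.le
    split_ifs
    · rw [hwq, mul_div_assoc', le_div_iff₀ hW0, mul_comm]
      refine mul_le_mul_of_nonneg_right ?_ (Real.rpow_nonneg (hW i) _)
      rwa [← hNq]
    · simp

/-! ### Hidden sign vectors and the `ℓ_p` ball -/

/-- If every coordinate of a hidden sign vector is hard to detect, the regret is large for some sign
vector. -/
lemma exists_signs_of_sums {n : ℕ} {I : Finset (Fin n)} {T a c h : ℝ}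
    {X R : (Fin n → Bool) → ℝ} {w : Fin n → (Fin n → Bool) → ℝ} (ha : 0 ≤ a)
    (hX : ∀ s, 0 ≤ X s) (hc : a * I.card * (T * (2 / 3 * h)) ≤ c)
    (hpair : ∀ s, ∀ i ∈ I, 2 / 3 * T ≤ w i s + w i (Function.update s i (!s i))
      + T * (2 / 3 * h * (X s + X (Function.update s i (!s i)))))
    (hR : ∀ s, c * X s + a * ∑ i ∈ I, w i s ≤ R s) :
    ∃ s, a * I.card * T / 3 ≤ R s := by
  by_contra! hcon
  have hflip : ∀ i, Function.Involutive fun s : Fin n → Bool => Function.update s i (!s i) := by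
    intro i s
    simp
  -- Flipping bit `i` permutes the sign vectors, so in the sum of the pair bounds over all `s` each
  -- term appears twice.
  have hsum : ∀ (i : Fin n) (g : (Fin n → Bool) → ℝ),
      ∑ s, g (Function.update s i (!s i)) = ∑ s, g s := fun i g =>
    Equiv.sum_comp (hflip i).toPerm g
  have h1 : ∀ i ∈ I, ∑ _s : Fin n → Bool, T / 3 ≤ ∑ s, w i s + T * (2 / 3 * h) * ∑ s, X s := by
    intro i hi
    have h2 := Finset.sum_le_sum fun s (_ : s ∈ Finset.univ) => hpair s i hi
    have h3 : ∑ s, (w i s + w i (Function.update s i (!s i))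
        + T * (2 / 3 * h * (X s + X (Function.update s i (!s i)))))
        = 2 * (∑ s, w i s + T * (2 / 3 * h) * ∑ s, X s) := by
      simp only [Finset.sum_add_distrib, ← Finset.mul_sum, hsum i (w i), hsum i X]
      ring
    have h4 : ∑ _s : Fin n → Bool, 2 / 3 * T = 2 * ∑ _s : Fin n → Bool, T / 3 := by
      rw [Finset.mul_sum]
      exact Finset.sum_congr rfl fun _ _ => by ring
    rw [h3, h4] at h2
    linarith
  have h5 := Finset.sum_le_sum h1
  have h6 : ∑ s, R s < ∑ _s : Fin n → Bool, a * I.card * T / 3 :=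
    Finset.sum_lt_sum_of_nonempty Finset.univ_nonempty fun s _ => hcon s
  have h7 := Finset.sum_le_sum fun s (_ : s ∈ Finset.univ) => hR s
  have hXs : 0 ≤ ∑ s, X s := Finset.sum_nonneg fun s _ => hX s
  simp only [Finset.sum_add_distrib, ← Finset.mul_sum, Finset.sum_const, nsmul_eq_mul] at h5 h6 h7
  rw [Finset.sum_comm] at h7
  have h8 := mul_le_mul_of_nonneg_left h5 ha
  have h9 := mul_le_mul_of_nonneg_right hc hXs
  nlinarith

/-- The real number `±1` coded by a Boolean. -/
def boolSign (b : Bool) : ℝ := if b = true then 1 else -1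

lemma abs_boolSign (b : Bool) : |boolSign b| = 1 := by cases b <;> simp [boolSign]

lemma boolSign_not (b : Bool) : boolSign (!b) = -boolSign b := by cases b <;> simp [boolSign]

/-- The weights of the hidden mean: a known coordinate `o` of weight `1 / 2`, and the weight `β` on
all others. -/
noncomputable def hiddenWeight {n : ℕ} (o : Fin n) (β : ℝ) (i : Fin n) : ℝ :=
  if i = o then 1 / 2 else β

/-- The signs of the hidden mean: `+1` at the known coordinate `o`, and arbitrary elsewhere. -/
noncomputable def hiddenSign {n : ℕ} (o : Fin n) (s : Fin n → Bool) (i : Fin n) : ℝ :=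
  if i = o then 1 else boolSign (s i)

lemma abs_hiddenSign {n : ℕ} (o : Fin n) (s : Fin n → Bool) (i : Fin n) :
    |hiddenSign o s i| = 1 := by
  unfold hiddenSign
  split_ifs
  exacts [abs_one, abs_boolSign _]

/-- The Gaussian loss law with mean `-(hiddenWeight * hiddenSign)` and independent coordinates, of
variance `v` except at the deterministic coordinate `o`. -/
noncomputable def hiddenLaw {n : ℕ} (o : Fin n) (β : ℝ) (v : NNReal) (s : Fin n → Bool)
    (i : Fin n) : Measure ℝ :=
  gaussianReal (-(hiddenWeight o β i * hiddenSign o s i)) (if i = o then 0 else v)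

instance {n : ℕ} (o : Fin n) (β : ℝ) (v : NNReal) (s : Fin n → Bool) (i : Fin n) :
    IsProbabilityMeasure (hiddenLaw o β v s i) := by
  unfold hiddenLaw; infer_instance

section Moment

variable {n : ℕ} {q : ℝ≥0∞}

lemma sum_hiddenWeight_rpow (o : Fin n) (β r : ℝ) :
    ∑ i, hiddenWeight o β i ^ r = (1 / 2) ^ r + (Finset.univ.erase o).card * β ^ r := by
  rw [← Finset.add_sum_erase _ _ (Finset.mem_univ o)]
  congr 1
  · simp [hiddenWeight]
  · rw [← nsmul_eq_mul, ← Finset.sum_const]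
    refine Finset.sum_congr rfl fun i hi => ?_
    rw [hiddenWeight, if_neg (Finset.ne_of_mem_erase hi)]

lemma integrable_abs_rpow_hiddenLaw (hq1 : 1 ≤ q.toReal) (hq2 : q.toReal < 2) (o : Fin n) (β : ℝ)
    (v : NNReal) (s : Fin n → Bool) (i : Fin n) :
    Integrable (fun h : Fin n → ℝ => |h i| ^ q.toReal) (Measure.pi (hiddenLaw o β v s)) :=
  (measurePreserving_eval (hiddenLaw o β v s) i).integrable_comp_of_integrable
    (integrable_abs_rpow_gaussianReal (by linarith) hq2.le _ _)

lemma integrable_ellNorm_hiddenLaw (hq1 : 1 ≤ q.toReal) (hq2 : q.toReal < 2) (o : Fin n) (β : ℝ)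
    (v : NNReal) (s : Fin n → Bool) :
    Integrable (fun h => ellNorm q h ^ q.toReal) (Measure.pi (hiddenLaw o β v s)) := by
  simp only [ellNorm_rpow (by linarith : 0 < q.toReal)]
  exact integrable_finsetSum _ fun i _ => integrable_abs_rpow_hiddenLaw hq1 hq2 o β v s i

/-- The known coordinate contributes `(1/2)^q ≤ 1/2`, and the others at most `3 n τ^q ≤ 3/8` in
total. -/
lemma integral_ellNorm_hiddenLaw_le (hq1 : 1 ≤ q.toReal) (hq2 : q.toReal < 2) (o : Fin n)
    {β τ : ℝ} (hβ0 : 0 ≤ β) (hβ : β ≤ τ) (hτ : 0 < τ) {v : NNReal} (hv : (v : ℝ) ≤ τ ^ 2)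
    (hτq : n * τ ^ q.toReal ≤ 1 / 8) (s : Fin n → Bool) :
    ∫ h, ellNorm q h ^ q.toReal ∂Measure.pi (hiddenLaw o β v s) ≤ 1 := by
  simp only [ellNorm_rpow (by linarith : 0 < q.toReal)]
  rw [integral_finsetSum _ fun i _ => integrable_abs_rpow_hiddenLaw hq1 hq2 o β v s i,
    ← Finset.add_sum_erase _ _ (Finset.mem_univ o)]
  have hcoord : ∀ i, ∫ h : Fin n → ℝ, |h i| ^ q.toReal ∂Measure.pi (hiddenLaw o β v s)
      = ∫ y, |y| ^ q.toReal ∂hiddenLaw o β v s i := fun i =>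
    integral_eval_pi (hiddenLaw o β v s) i (fun y => |y| ^ q.toReal) (by fun_prop)
  have h1 : ∫ h : Fin n → ℝ, |h o| ^ q.toReal ∂Measure.pi (hiddenLaw o β v s) ≤ 1 / 2 := by
    rw [hcoord, hiddenLaw, if_pos rfl, gaussianReal_zero_var, integral_dirac]
    have : |-(hiddenWeight o β o * hiddenSign o s o)| = 1 / 2 := by
      simp [hiddenWeight, hiddenSign]
    rw [this]
    have := Real.rpow_le_rpow_of_exponent_ge (by norm_num : (0 : ℝ) < 1 / 2) (by norm_num) hq1
    rwa [Real.rpow_one] at this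
  have h2 : ∑ i ∈ Finset.univ.erase o, ∫ h : Fin n → ℝ, |h i| ^ q.toReal
      ∂Measure.pi (hiddenLaw o β v s) ≤ ∑ i ∈ Finset.univ.erase o, 3 * τ ^ q.toReal := by
    refine Finset.sum_le_sum fun i hi => ?_
    have hi' := Finset.ne_of_mem_erase hi
    rw [hcoord, hiddenLaw, if_neg hi']
    refine integral_abs_rpow_gaussianReal_le (by linarith) hq2.le hτ ?_ hv
    rwa [abs_neg, abs_mul, abs_hiddenSign, mul_one, hiddenWeight, if_neg hi', abs_of_nonneg hβ0]
  have h3 : ((Finset.univ.erase o).card : ℝ) ≤ n := by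
    exact_mod_cast (Finset.card_le_univ _).trans (by simp)
  rw [Finset.sum_const, nsmul_eq_mul] at h2
  have h4 := mul_le_mul_of_nonneg_right h3 (by positivity : 0 ≤ 3 * τ ^ q.toReal)
  linarith

end Moment

section Regret

variable {Ω : Type*} [MeasurableSpace Ω] {n T : ℕ} {p q : ℝ≥0∞}

/-- The indicator of the event that coordinate `i` of the point played has a wrong sign. -/
noncomputable def wrongSign (S : Strategy Ω (Fin n × Bool) (ellBall n p)) (i : Fin n)
    (s : Fin n → Bool) (t : ℕ) (x : Ω × (Fin t → Signal (Fin n × Bool))) : ℝ :=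
  if boolSign (s i) * S.meanPlayed signedBasisVec t x i ≤ 0 then 1 else 0

variable (S : Strategy Ω (Fin n × Bool) (ellBall n p))

lemma measurable_wrongSign (i : Fin n) (s : Fin n → Bool) (t : ℕ) :
    Measurable (wrongSign S i s t) :=
  Measurable.ite (measurableSet_le (((measurable_pi_apply i).comp
    (S.measurable_meanPlayed signedBasisVec t)).const_mul _) measurable_const)
    measurable_const measurable_const

lemma wrongSign_nonneg (i : Fin n) (s : Fin n → Bool) (t : ℕ)
    (x : Ω × (Fin t → Signal (Fin n × Bool))) : 0 ≤ wrongSign S i s t x := by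
  unfold wrongSign; split_ifs <;> norm_num

lemma wrongSign_le_one (i : Fin n) (s : Fin n → Bool) (t : ℕ)
    (x : Ω × (Fin t → Signal (Fin n × Bool))) : wrongSign S i s t x ≤ 1 := by
  unfold wrongSign; split_ifs <;> norm_num

/-- A zero coordinate counts as wrong for both signs, so the complement of an error under `s` is
always an error under the flipped vector. -/
lemma one_sub_wrongSign_le (i : Fin n) (s : Fin n → Bool) (t : ℕ)
    (x : Ω × (Fin t → Signal (Fin n × Bool))) :
    1 - wrongSign S i s t x ≤ wrongSign S i (Function.update s i (!s i)) t x := by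
  unfold wrongSign
  rw [Function.update_self, boolSign_not, neg_mul]
  split_ifs <;> linarith

lemma integrable_wrongSign (i : Fin n) (s : Fin n → Bool) (t : ℕ)
    (P : Measure (Ω × (Fin t → Signal (Fin n × Bool)))) [IsProbabilityMeasure P] :
    Integrable (wrongSign S i s t) P :=
  Integrable.of_bound (measurable_wrongSign S i s t).aestronglyMeasurable 1
    (Filter.Eventually.of_forall fun x => by
      rw [Real.norm_of_nonneg (wrongSign_nonneg S i s t x)]; exact wrongSign_le_one S i s t x)

variable [Nonempty (Fin n)]

/-- The sign of a coordinate `i ≠ o` is hard to detect. -/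
lemma wrongSign_pair_ge {o i : Fin n} (hi : i ≠ o) {β : ℝ} {v h : NNReal} (hv : v ≠ 0)
    (hh : (2 * β) ^ 2 / (8 * v) ≤ h) (s : Fin n → Bool) :
    2 / 3 * (T : ℝ) ≤ ∑ t ∈ Finset.range T, ∫ x, wrongSign S i s t x
        ∂S.obsLaw signedBasisVec (Measure.pi (hiddenLaw o β v s)) t
      + ∑ t ∈ Finset.range T, ∫ x, wrongSign S i (Function.update s i (!s i)) t x
        ∂S.obsLaw signedBasisVec
          (Measure.pi (hiddenLaw o β v (Function.update s i (!s i)))) t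
      + T * (2 / 3 * (h / n) * (S.exploreCount signedBasisVec
          (Measure.pi (hiddenLaw o β v s)) T
        + S.exploreCount signedBasisVec
          (Measure.pi (hiddenLaw o β v (Function.update s i (!s i)))) T)) := by
  have H := isLikelihoodRatio_coordLikelihood (isSignedBasis_signedBasisVec n)
    (κ := hiddenLaw o β v s) (κ' := hiddenLaw o β v (Function.update s i (!s i))) (j := i)
    (measurable_gaussianRatio (-(hiddenWeight o β i * hiddenSign o s i))
      (-(hiddenWeight o β i * hiddenSign o (Function.update s i (!s i)) i)) v)
    (fun k hk => by simp [hiddenLaw, hiddenSign, hk])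
    (by
      simp only [hiddenLaw, if_neg hi]
      exact gaussianReal_eq_withDensity _ _ hv) (h := h) (by
      simp only [hiddenLaw, if_neg hi]
      refine one_le_affinity_gaussian _ _ hv (le_trans (le_of_eq ?_) hh)
      congr 1
      simp only [hiddenWeight, hiddenSign, if_neg hi, Function.update_self, boolSign_not]
      have := abs_mul_abs_self (boolSign (s i))
      rw [abs_boolSign] at this
      linear_combination (-4 * β ^ 2) * this)
  have key := S.sum_test_ge (T := T) H (f := wrongSign S i s) (measurable_wrongSign S i s)
    (wrongSign_nonneg S i s) (wrongSign_le_one S i s)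
  rw [NNReal.coe_div, NNReal.coe_natCast] at key
  refine key.trans ?_
  gcongr with t _
  · exact (integrable_const 1).sub (integrable_wrongSign S i s t _)
  · exact integrable_wrongSign S i _ t _
  · exact one_sub_wrongSign_le S i s t

/-- Each exploratory round and each wrong sign is paid for. -/
lemma exploreCount_add_wrongSign_le (hp : 2 < p) (hpq : p⁻¹ + q⁻¹ = 1) (o : Fin n) {β : ℝ}
    (hβ : 0 ≤ β) (hβq : n * β ^ q.toReal ≤ 1 / 8) (v : NNReal) (s : Fin n → Bool) :
    1 / 4 * S.exploreCount signedBasisVec (Measure.pi (hiddenLaw o β v s)) T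
      + β ^ q.toReal / 2 * ∑ i ∈ Finset.univ.erase o, ∑ t ∈ Finset.range T,
        ∫ x, wrongSign S i s t x ∂S.obsLaw signedBasisVec (Measure.pi (hiddenLaw o β v s)) t
      ≤ ∫ ℓ : Fin T → Fin n → ℝ, S.regret signedBasisVec ℓ
        ∂(Measure.pi fun _ => Measure.pi (hiddenLaw o β v s)) := by
  obtain ⟨hq1, hq2, -⟩ := toReal_conj hp hpq
  have hq0 : 0 < q.toReal := by linarith
  have hcard : ((Finset.univ.erase o).card : ℝ) ≤ n := by
    exact_mod_cast (Finset.card_le_univ _).trans (by simp)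
  have hβq0 : 0 ≤ β ^ q.toReal := Real.rpow_nonneg hβ _
  have hcβ : ((Finset.univ.erase o).card : ℝ) * β ^ q.toReal ≤ 1 / 8 :=
    (mul_le_mul_of_nonneg_right hcard hβq0).trans hβq
  have hhalf : ((1 : ℝ) / 2) ^ q.toReal ≤ 1 / 2 := by
    have := Real.rpow_le_rpow_of_exponent_ge (by norm_num : (0 : ℝ) < 1 / 2) (by norm_num) hq1
    rwa [Real.rpow_one] at this
  have hhalf0 : (0 : ℝ) < (1 / 2) ^ q.toReal := by positivity
  have hW0 : ∀ i, 0 ≤ hiddenWeight o β i := fun i => by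
    unfold hiddenWeight; split_ifs
    exacts [by norm_num, hβ]
  have hcβ0 : 0 ≤ ((Finset.univ.erase o).card : ℝ) * β ^ q.toReal := by positivity
  obtain ⟨N, hN0, hNq, hmin⟩ := exists_minimizer_ellBall hp hpq hW0
    (by rw [sum_hiddenWeight_rpow]; linarith) (by rw [sum_hiddenWeight_rpow]; linarith)
  -- The known coordinate alone makes the optimal value at most `-1/2`. The exploratory mean is the
  -- origin, so an explored round has regret `N`.
  have hN : 1 / 2 ≤ N := by
    rw [sum_hiddenWeight_rpow] at hNq
    exact (Real.rpow_le_rpow_iff (by norm_num) hN0.le hq0).1 (by linarith)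
  obtain ⟨y, hy, hθy, hgap⟩ := hmin (hiddenSign o s) (abs_hiddenSign o s)
  have hp1 : 1 ≤ p := le_trans (by norm_num) hp.le
  have hlaw : ∀ i, Integrable (fun h : Fin n → ℝ => h i) (Measure.pi (hiddenLaw o β v s)) :=
    fun i => integrable_eval_pi _
      ((memLp_id_gaussianReal' 1 (by simp)).integrable le_rfl)
  have hmean : ∀ i, ∫ h, h i ∂Measure.pi (hiddenLaw o β v s)
      = -(hiddenWeight o β i * hiddenSign o s i) := fun i => by
    rw [integral_eval_pi _ i (fun y => y) measurable_id]
    exact integral_id_gaussianReal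
  have key := S.exploreCount_add_le_integral_regret (T := T) (abs_le_one_of_mem_ellBall hp1)
    (isSignedBasis_signedBasisVec n).abs_le_one hlaw hmean hy (c := 1 / 4)
    (g := fun t x => β ^ q.toReal / 2 * ∑ i ∈ Finset.univ.erase o, wrongSign S i s t x)
    (fun t => (integrable_finsetSum _ fun i _ => integrable_wrongSign S i s t _).const_mul _)
    (fun t x => by
      rw [hθy, sub_neg_eq_add]
      by_cases he : S.explore t x.1 x.2 = true
      · have hmp : S.meanPlayed signedBasisVec t x = 0 := by
          rw [meanPlayed_of_explore S _ he]
          funext i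
          exact expect_signedBasisVec i
        rw [if_pos he, hmp, dotProduct_zero]
        -- In an explored round all signs count as wrong, so both charges must fit into `N`: `1/4 +
        -- 1/16 ≤ 1/2`.
        have h1 : ∑ i ∈ Finset.univ.erase o, wrongSign S i s t x
            ≤ ((Finset.univ.erase o).card : ℝ) :=
          (Finset.sum_le_card_nsmul _ _ 1 fun i _ => wrongSign_le_one S i s t x).trans (by simp)
        have h2 := mul_le_mul_of_nonneg_left h1 (by positivity : 0 ≤ β ^ q.toReal / 2)
        linarith
      · rw [if_neg he, zero_add]
        have hmem : S.meanPlayed signedBasisVec t x ∈ ellBall n p := by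
          rw [meanPlayed_of_not_explore S _ he]
          exact S.action_mem _ _ _
        refine le_trans ?_ (hgap _ hmem)
        have h1 : β ^ q.toReal * ∑ i ∈ Finset.univ.erase o, wrongSign S i s t x
            ≤ ∑ i, if hiddenSign o s i * S.meanPlayed signedBasisVec t x i ≤ 0
              then hiddenWeight o β i ^ q.toReal else 0 := by
          rw [Finset.mul_sum, ← Finset.add_sum_erase _ _ (Finset.mem_univ o)]
          refine le_add_of_nonneg_of_le ?_ (le_of_eq (Finset.sum_congr rfl fun i hi => ?_))
          · split_ifs
            exacts [Real.rpow_nonneg (hW0 o) _, le_rfl]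
          · have hi' := Finset.ne_of_mem_erase hi
            simp only [wrongSign, hiddenSign, hiddenWeight, if_neg hi']
            split_ifs <;> simp
        have h0 : 0 ≤ β ^ q.toReal * ∑ i ∈ Finset.univ.erase o, wrongSign S i s t x :=
          mul_nonneg hβq0 (Finset.sum_nonneg fun i _ => wrongSign_nonneg S i s t x)
        -- The factor `1/q` of the gap is weakened to `1/2`, as `q < 2`.
        rw [div_mul_eq_mul_div]
        exact div_le_div₀ (h0.trans h1) h1 hq0 hq2.le)
  refine le_trans (le_of_eq ?_) key
  congr 1
  simp only [integral_const_mul, ← Finset.mul_sum]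
  congr 1
  rw [Finset.sum_comm]
  exact Finset.sum_congr rfl fun t _ =>
    (integral_finsetSum _ fun i _ => integrable_wrongSign S i s t _).symm

end Regret

/-- The constant does not depend on `p`, because `q` stays in `[1, 2)`. The law is a degenerate
Gaussian: the known coordinate has variance zero. -/
theorem exists_gaussian_loss_law {p q : ℝ≥0∞} (hp : 2 < p) (hpq : p⁻¹ + q⁻¹ = 1) {n T : ℕ}
    (hn : 2 ≤ n) (hT : n ≤ T) {Ω : Type*} [MeasurableSpace Ω]
    (S : Strategy Ω (Fin n × Bool) (ellBall n p)) :
    ∃ ν : Measure (Fin n → ℝ), IsGaussian ν ∧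
      Integrable (fun h => ellNorm q h ^ q.toReal) ν ∧
      ∫ h, ellNorm q h ^ q.toReal ∂ν ≤ 1 ∧
      Integrable (fun ℓ : Fin T → Fin n → ℝ => S.regret signedBasisVec ℓ)
        (Measure.pi fun _ => ν) ∧
      1 / 768 * (n : ℝ) ^ (q.toReal / (2 + q.toReal)) * (T : ℝ) ^ (2 / (2 + q.toReal))
        ≤ ∫ ℓ : Fin T → Fin n → ℝ, S.regret signedBasisVec ℓ ∂(Measure.pi fun _ => ν) := by
  obtain ⟨hq1, hq2, -⟩ := toReal_conj hp hpq
  have hq0 : 0 < q.toReal := by linarith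
  have hn0 : (0 : ℝ) < n := by exact_mod_cast (by omega : 0 < n)
  have : Nonempty (Fin n) := ⟨⟨0, by omega⟩⟩
  set o : Fin n := ⟨0, by omega⟩
  obtain ⟨ε, hε0, hε1, hε, hεT⟩ := explorationScale_rpow hq0 (by omega : 0 < n) hT
  -- This normalization makes `n τ^q = (1/8)^q`, which lies between `1/64` and `1/8`: small enough
  -- for the moment bound, yet bounded below.
  set τ : ℝ := 1 / 8 * (n : ℝ) ^ (-(1 / q.toReal)) with hτdef
  have hτ : 0 < τ := by positivity
  set k : ℝ := (1 / 8) ^ q.toReal with hk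
  have hk1 : k ≤ 1 / 8 := by
    have := Real.rpow_le_rpow_of_exponent_ge (by norm_num : (0 : ℝ) < 1 / 8) (by norm_num) hq1
    rwa [Real.rpow_one] at this
  have hk2 : 1 / 64 ≤ k := by
    have := Real.rpow_le_rpow_of_exponent_ge (by norm_num : (0 : ℝ) < 1 / 8) (by norm_num) hq2.le
    rw [Real.rpow_two] at this
    norm_num at this ⊢
    exact this
  have hτq : n * τ ^ q.toReal = k := by
    rw [hτdef, Real.mul_rpow (by norm_num) (by positivity), ← Real.rpow_mul hn0.le, neg_mul,
      one_div_mul_cancel hq0.ne', Real.rpow_neg_one, mul_left_comm, mul_inv_cancel₀ hn0.ne',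
      mul_one]
  have hβq : n * (τ * ε) ^ q.toReal = k * ε ^ q.toReal := by
    rw [Real.mul_rpow hτ.le hε0.le, ← mul_assoc, hτq]
  have hεq1 : ε ^ q.toReal ≤ 1 := Real.rpow_le_one hε0.le hε1 hq0.le
  have hβq8 : n * (τ * ε) ^ q.toReal ≤ 1 / 8 := by
    rw [hβq]
    exact (mul_le_of_le_one_right (by linarith) hεq1).trans hk1
  set v : NNReal := (τ ^ 2).toNNReal with hv
  have hvτ : (v : ℝ) = τ ^ 2 := Real.coe_toNNReal _ (by positivity)
  have hv0 : v ≠ 0 := by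
    intro h0
    rw [h0, NNReal.coe_zero] at hvτ
    exact (by positivity : τ ^ 2 ≠ 0) hvτ.symm
  -- Opposite signs differ in mean by `2τε` at variance `τ²`, and `(2τε)² / (8τ²) = ε²/2`.
  set h : NNReal := (ε ^ 2 / 2).toNNReal
  have hh : (h : ℝ) = ε ^ 2 / 2 := Real.coe_toNNReal _ (by positivity)
  have hcard : ((Finset.univ.erase o).card : ℝ) = n - 1 := by
    rw [Finset.card_erase_of_mem (Finset.mem_univ o), Finset.card_univ, Fintype.card_fin,
      Nat.cast_sub (by omega), Nat.cast_one]
  have hβ0 : 0 ≤ (τ * ε) ^ q.toReal := by positivity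
  obtain ⟨s, hs⟩ := exists_signs_of_sums (I := Finset.univ.erase o) (T := T)
    (a := (τ * ε) ^ q.toReal / 2) (c := 1 / 4) (h := h / n)
    (X := fun s => S.exploreCount signedBasisVec (Measure.pi (hiddenLaw o (τ * ε) v s)) T)
    (R := fun s => ∫ ℓ : Fin T → Fin n → ℝ, S.regret signedBasisVec ℓ
      ∂(Measure.pi fun _ => Measure.pi (hiddenLaw o (τ * ε) v s)))
    (w := fun i s => ∑ t ∈ Finset.range T, ∫ x, wrongSign S i s t x
      ∂S.obsLaw signedBasisVec (Measure.pi (hiddenLaw o (τ * ε) v s)) t)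
    (by positivity) (fun s => S.exploreCount_nonneg _ _ _)
    (by
      have h1 : (τ * ε) ^ q.toReal / 2 * (Finset.univ.erase o).card ≤ k * ε ^ q.toReal / 2 := by
        rw [hcard, ← hβq]
        nlinarith
      refine (mul_le_mul_of_nonneg_right h1 (by positivity)).trans ?_
      have h2 : k * ε ^ q.toReal / 2 * (T * (2 / 3 * (h / n)))
          = k / 6 * (ε ^ q.toReal * ε ^ 2 * T) / n := by
        rw [hh]; ring
      rw [h2, hε, mul_div_assoc, div_self hn0.ne']
      linarith)
    (fun s i hi => wrongSign_pair_ge S (Finset.ne_of_mem_erase hi) hv0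
      (by rw [hvτ, hh]; apply le_of_eq; field_simp; ring) s)
    (fun s => exploreCount_add_wrongSign_le S hp hpq o (by positivity) hβq8 v s)
  refine ⟨Measure.pi (hiddenLaw o (τ * ε) v s), isGaussian_pi_gaussianReal _ _,
    integrable_ellNorm_hiddenLaw hq1 hq2 o _ v s,
    integral_ellNorm_hiddenLaw_le hq1 hq2 o (by positivity)
      (mul_le_of_le_one_right hτ.le hε1) hτ hvτ.le (hτq.le.trans hk1) s, ?_, le_trans ?_ hs⟩
  · have hp1 : 1 ≤ p := le_trans (by norm_num) hp.le
    obtain ⟨y, hy⟩ : (ellBall n p).Nonempty := ⟨_, S.action_mem 0 (Classical.choice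
      (S.law.nonempty_of_neZero)) Fin.elim0⟩
    exact (S.integrable_regret (abs_le_one_of_mem_ellBall hp1) ⟨y, hy⟩
      (isSignedBasis_signedBasisVec n).abs_le_one fun i => integrable_eval_pi _
        ((memLp_id_gaussianReal' 1 (by simp)).integrable le_rfl)).2.2
  -- With `n - 1 ≥ n/2` and `n τ^q ≥ 1/64`, the constant is `1/64 · 1/4 · 1/3 = 1/768`.
  · rw [mul_assoc, ← hεT, hcard]
    have hn2 : (2 : ℝ) ≤ n := by exact_mod_cast hn
    have h1 : n * ((τ * ε) ^ q.toReal) / 4 ≤ (τ * ε) ^ q.toReal / 2 * (n - 1) := by nlinarith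
    have hE : 0 ≤ ε ^ q.toReal := by positivity
    have h2 : 1 / 64 * ε ^ q.toReal / 4 ≤ (τ * ε) ^ q.toReal / 2 * (n - 1) := by
      refine le_trans ?_ h1
      rw [hβq]
      have := mul_le_mul_of_nonneg_right hk2 hE
      linarith
    have h3 := mul_le_mul_of_nonneg_right h2 (Nat.cast_nonneg (α := ℝ) T)
    linarith

end StarvedBandit

theorem theorem5 :
    -- the starved multi-armed bandit
    (∀ (n T : ℕ), 3 ≤ n → n ≤ T →
      ∀ (Ω : Type*) [MeasurableSpace Ω]
        (S : StarvedBandit.Strategy Ω (Fin n) (StarvedBandit.arms n)),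
      ∃ ℓ : Fin T → Fin n → ℝ, (∀ t, ℓ t ∈ StarvedBandit.polarBody (StarvedBandit.arms n)) ∧
        1 / 20 * (n : ℝ) ^ (1 / 3 : ℝ) * (T : ℝ) ^ (2 / 3 : ℝ)
          ≤ S.regret StarvedBandit.basisVec ℓ) ∧
    -- the starved linear bandit on the unit ball of `ℓ_1^n`
    (∀ (n T : ℕ), 2 ≤ n → n ≤ T →
      ∀ (Ω : Type*) [MeasurableSpace Ω]
        (S : StarvedBandit.Strategy Ω (Fin n × Bool) (StarvedBandit.ellBall n 1)),
      ∃ ℓ : Fin T → Fin n → ℝ, (∀ t, ℓ t ∈ StarvedBandit.polarBody (StarvedBandit.ellBall n 1)) ∧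
        1 / 20 * (n : ℝ) ^ (1 / 3 : ℝ) * (T : ℝ) ^ (2 / 3 : ℝ)
          ≤ S.regret StarvedBandit.signedBasisVec ℓ) ∧
    -- the starved linear bandit on the unit ball of `ℓ_p^n`, for `p > 2`
    (∀ (p q : ℝ≥0∞), 2 < p → p⁻¹ + q⁻¹ = 1 →
      ∃ C : ℝ, 0 < C ∧
        ∀ (n T : ℕ), 2 ≤ n → n ≤ T →
        ∀ (Ω : Type*) [MeasurableSpace Ω]
          (S : StarvedBandit.Strategy Ω (Fin n × Bool) (StarvedBandit.ellBall n p)),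
        ∃ ν : Measure (Fin n → ℝ), IsGaussian ν ∧
          Integrable (fun h => StarvedBandit.ellNorm q h ^ q.toReal) ν ∧
          ∫ h, StarvedBandit.ellNorm q h ^ q.toReal ∂ν ≤ 1 ∧
          Integrable (fun ℓ : Fin T → Fin n → ℝ => S.regret StarvedBandit.signedBasisVec ℓ)
            (Measure.pi fun _ => ν) ∧
          C * (n : ℝ) ^ (q.toReal / (2 + q.toReal)) * (T : ℝ) ^ (2 / (2 + q.toReal))
            ≤ ∫ ℓ : Fin T → Fin n → ℝ, S.regret StarvedBandit.signedBasisVec ℓ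
                ∂(Measure.pi fun _ => ν)) := by
  refine ⟨fun n T hn hT Ω _ S => StarvedBandit.exists_loss_arms hn hT S,
    fun n T hn hT Ω _ S => StarvedBandit.exists_loss_ellBall_one hn hT S,
    fun p q hp hpq => ⟨1 / 768, by norm_num, fun n T hn hT Ω _ S =>
      StarvedBandit.exists_gaussian_loss_law hp hpq hn hT S⟩⟩
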